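/- Let $\mathbb K=\mathbb R$ or $\mathbb C$. A norming dual pair $(X,Y)$ consists of Banach spaces $X,Y$ over $\mathbb K$ and a bilinear form $\langle\cdot,\cdot\rangle:X\times Y\to\mathbb K$ with $\|x\|=\sup_{\|y\|\le1}|\langle x,y\rangle|$ for all $x\in X$ and $\|y\|=\sup_{\|x\|\le1}|\langle x,y\rangle|$ for all $y\in Y$. Let $\sigma(X,Y)$ be the weak topology on $X$ and $\mu(X,Y)$ the Mackey topology on $X$, i.e. the topology of uniform convergence on the absolutely convex $\sigma(Y,X)$-compact subsets of $Y$; $\sigma(Y,X)$ and $\mu(Y,X)$ are defined likewise on $Y$. A locally convex topology is quasicomplete if every bounded closed set is complete. A semigroup on $(X,Y)$ is a family $(T(t))_{t\ge0}$ of $\sigma(X,Y)$-continuous linear operators on $X$ with $T(0)=I$, $T(t+s)=T(t)T(s)$ and, for some $M\ge1$, $\omega\in\mathbb R$, $\|T(t)\|\le Me^{\omega t}$ for all $t\ge0$ (type $(M,\omega)$). For $\mathbb K=\mathbb C$ it is called integrable if, for such $M,\omega$ and every $\lambda$ with $\operatorname{Re}\lambda>\omega$, there is a $\sigma(X,Y)$-continuous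 linear operator $R(\lambda)$ on $X$ with $\langle R(\lambda)x,y\rangle=\int_0^\infty e^{-\lambda t}\langle T(t)x,y\rangle\,dt$ for all $x\in X$, $y\in Y$, all these integrals being assumed to exist. For a locally convex topology $\tau$ on $X$, $(T(t))_{t\ge 0}$ is $\tau$-continuous if $t\mapsto T(t)x$ is $\tau$-continuous on $[0,\infty)$ for every $x\in X$; it is quasi-$\tau$-equicontinuous if there is $\alpha\in\mathbb R$ such that for every $\tau$-continuous seminorm $p$ there is a $\tau$-continuous seminorm $q$ with $p(e^{-\alpha t}T(t)x)\le q(x)$ for all $t\ge0$, $x\in X$. If $(X,Y)$ is a norming dual pair such that $\mu(Y,X)$ is quasicomplete, then every $\mu(X,Y)$-continuous semigroup on $(X,Y)$ is quasi-$\mu(X,Y)$-equicontinuous. Moreover: (1) If $(T(t))_{t\ge0}$ is a norm-continuous (i.e. strongly continuous) semigroup of bounded operators on a Banach space $X$, then its adjoint semigroup $(T(t)^*)_{t\ge0}$ on $X^*$ is $\mu(X^*,X)$-continuous if and only if it is quasi-$\mu(X^*,X)$-equicontinuous. (2) Let $E$ be a completely regular Hausdorff space, $C_b(E)$ the space of bounded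 continuous functions $E\to\mathbb C$, and $\mathcal M_0(E)$ the space of bounded complex Radon measures on $E$ (complex Borel measures $m$ with $|m|$ inner regular with respect to compact sets, normed by $|m|(E)$), paired by $\langle m,f\rangle=\int_E f\,dm$. Let $\beta_0$ be the topology on $C_b(E)$ generated by the seminorms $f\mapsto\|\varphi f\|_\infty$, where $\varphi$ ranges over the bounded functions on $E$ such that for every $\varepsilon>0$ there is a compact $K\subset E$ with $|\varphi|\le\varepsilon$ off $K$. If $(C_b(E),\beta_0)$ is complete, then every $\mu(\mathcal M_0(E),C_b(E))$-continuous integrable semigroup on $(\mathcal M_0(E),C_b(E))$ is quasi-$\mu(\mathcal M_0(E),C_b(E))$-equicontinuous. -/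

import Mathlib

open Topology MeasureTheory
open scoped NNReal ENNReal BoundedContinuousFunction

noncomputable section

/-! ### Topologies defined by seminorms and by a pairing -/

section Topologies

variable {𝕜 : Type*} [RCLike 𝕜] {X : Type*} [AddCommGroup X] [Module 𝕜 X]
  {Y : Type*} [AddCommGroup Y] [Module 𝕜 Y]

/-- The uniform structure generated by a set of seminorms; its topology is the locally convex
topology generated by these seminorms. -/
@[reducible]
def seminormUniformity (P : Set (Seminorm 𝕜 X)) : UniformSpace X :=
  ⨅ p ∈ P, p.toSeminormedAddCommGroup.toUniformSpace

/-- The seminorm `p_M x = sup_{y ∈ M} |⟨x, y⟩|` of a set `M ⊆ Y` that is bounded for the pairing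
(see `pairingSeminorm_apply`); it is used for such sets only. -/
def pairingSeminorm (B : X →ₗ[𝕜] Y →ₗ[𝕜] 𝕜) (M : Set Y) : Seminorm 𝕜 X :=
  ⨆ y : M, (B.flip y).toSeminorm

theorem pairingSeminorm_apply (B : X →ₗ[𝕜] Y →ₗ[𝕜] 𝕜) (M : Set Y)
    (hM : ∀ x, BddAbove (Set.range fun y : M => ‖B x y‖)) (x : X) :
    pairingSeminorm B M x = ⨆ y : M, ‖B x y‖ := by
  unfold pairingSeminorm
  rw [Seminorm.iSup_apply (Seminorm.bddAbove_range_iff.mpr fun x => by simpa using hM x)]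
  simp

/-- The weak topology `σ(X, Y)` on `X`. -/
@[reducible]
def weakTopology (B : X →ₗ[𝕜] Y →ₗ[𝕜] 𝕜) : TopologicalSpace X :=
  TopologicalSpace.induced (fun x y => B x y) Pi.topologicalSpace

/-- Absolutely convex sets in a vector space over `𝕜 = ℝ` or `ℂ`. -/
def IsAbsolutelyConvex (𝕜 : Type*) [RCLike 𝕜] {Y : Type*} [AddCommGroup Y] [Module 𝕜 Y]
    (K : Set Y) : Prop :=
  ∀ y ∈ K, ∀ z ∈ K, ∀ a b : 𝕜, ‖a‖ + ‖b‖ ≤ 1 → a • y + b • z ∈ K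

/-- The Mackey uniformity of the dual pair `(X, Y)` on `X`: uniform convergence on the absolutely
convex, `σ(Y, X)`-compact subsets of `Y`. -/
@[reducible]
def mackeyUniformity (B : X →ₗ[𝕜] Y →ₗ[𝕜] 𝕜) : UniformSpace X :=
  seminormUniformity (pairingSeminorm B ''
    {K : Set Y | IsAbsolutelyConvex 𝕜 K ∧ @IsCompact Y (weakTopology B.flip) K})

/-- The Mackey topology `μ(X, Y)` on `X`. -/
@[reducible]
def mackeyTopology (B : X →ₗ[𝕜] Y →ₗ[𝕜] 𝕜) : TopologicalSpace X :=
  (mackeyUniformity B).toTopologicalSpace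

/-- The sets that define the Mackey topology are bounded for the pairing. -/
theorem bddAbove_pairing_of_isCompact (B : X →ₗ[𝕜] Y →ₗ[𝕜] 𝕜) {K : Set Y}
    (hK : @IsCompact Y (weakTopology B.flip) K) (x : X) :
    BddAbove (Set.range fun y : K => ‖B x y‖) := by
  let _ : TopologicalSpace Y := weakTopology B.flip
  have hc : Continuous fun y : Y => ‖B x y‖ :=
    ((continuous_apply x).comp (continuous_induced_dom (f := fun y x => B.flip y x))).norm
  have h := (hK.image hc).bddAbove
  rwa [Set.image_eq_range] at h

/-- Quasicompleteness: every bounded closed set is complete. -/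
def IsQuasicomplete (𝕜 : Type*) [RCLike 𝕜] {X : Type*} [AddCommGroup X] [Module 𝕜 X]
    (u : UniformSpace X) : Prop :=
  ∀ S : Set X, Bornology.IsVonNBounded 𝕜 S → IsClosed S → IsComplete S

/-- Equicontinuity of a family of linear operators on `(X, τ)`. -/
def IsEquicontinuousFamily (τ : TopologicalSpace X) {ι : Type*} (S : ι → X →ₗ[𝕜] X) : Prop :=
  ∀ p : Seminorm 𝕜 X, Continuous p →
    ∃ q : Seminorm 𝕜 X, Continuous q ∧ ∀ i x, p (S i x) ≤ q x

/-- Quasi-equicontinuity: for some real `α`, the operators `e^{-α t} T(t)`, `t ≥ 0`, are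
equicontinuous. -/
def IsQuasiEquicontinuous (τ : TopologicalSpace X) (T : ℝ≥0 → X →ₗ[𝕜] X) : Prop :=
  ∃ α : ℝ, IsEquicontinuousFamily τ fun t : ℝ≥0 => ((Real.exp (-α * t) : ℝ) : 𝕜) • T t

/-- `τ`-continuity of a semigroup: all orbits `t ↦ T(t) x` are `τ`-continuous on `[0, ∞)`. -/
def HasContinuousOrbits (τ : TopologicalSpace X) (T : ℝ≥0 → X →ₗ[𝕜] X) : Prop :=
  ∀ x, Continuous fun t => T t x

end Topologies

/-! ### Norming dual pairs and their semigroups -/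

section Semigroups

variable {𝕜 : Type*} [RCLike 𝕜] {X : Type*} [NormedAddCommGroup X] [NormedSpace 𝕜 X]
  {Y : Type*} [NormedAddCommGroup Y] [NormedSpace 𝕜 Y]

/-- Norming dual pairs of normed spaces (in the theorem, of Banach spaces). The two identities
imply that the pairing separates points on both sides. -/
structure IsNormingDualPair (B : X →ₗ[𝕜] Y →ₗ[𝕜] 𝕜) : Prop where
  isLUB_left : ∀ x, IsLUB ((fun y => ‖B x y‖) '' {y | ‖y‖ ≤ 1}) ‖x‖
  isLUB_right : ∀ y, IsLUB ((fun x => ‖B x y‖) '' {x | ‖x‖ ≤ 1}) ‖y‖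

/-- The semigroup laws for a family of linear operators indexed by `[0, ∞)`. -/
structure IsOperatorSemigroup (T : ℝ≥0 → X →ₗ[𝕜] X) : Prop where
  zero : T 0 = LinearMap.id
  add : ∀ t s, T (t + s) = T t ∘ₗ T s

/-- `T` satisfies `‖T(t)‖ ≤ M e^{ω t}` for all `t ≥ 0`. -/
def IsOfType (T : ℝ≥0 → X →ₗ[𝕜] X) (M ω : ℝ) : Prop :=
  1 ≤ M ∧ ∀ t x, ‖T t x‖ ≤ M * Real.exp (ω * t) * ‖x‖

/-- A semigroup on the pair `(X, Y)`: an exponentially bounded semigroup of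
`σ(X, Y)`-continuous linear operators. -/
structure IsPairSemigroup (B : X →ₗ[𝕜] Y →ₗ[𝕜] 𝕜) (T : ℝ≥0 → X →ₗ[𝕜] X) : Prop
    extends IsOperatorSemigroup T where
  weak_continuous : ∀ t, Continuous[weakTopology B, weakTopology B] (T t)
  exists_type : ∃ M ω : ℝ, IsOfType T M ω

/-- An integrable semigroup on the (complex) pair `(X, Y)`: a semigroup, of some type `(M, ω)`,
with a Laplace transform `R(l)`, `Re l > ω`, that consists of `σ(X, Y)`-continuous operators. -/
structure IsIntegrableSemigroup {X : Type*} [NormedAddCommGroup X] [NormedSpace ℂ X]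
    {Y : Type*} [NormedAddCommGroup Y] [NormedSpace ℂ Y]
    (B : X →ₗ[ℂ] Y →ₗ[ℂ] ℂ) (T : ℝ≥0 → X →ₗ[ℂ] X) : Prop
    extends IsPairSemigroup B T where
  exists_laplace : ∃ M ω : ℝ, IsOfType T M ω ∧ ∀ l : ℂ, ω < l.re →
    ∃ R : X →ₗ[ℂ] X, Continuous[weakTopology B, weakTopology B] R ∧ ∀ x y,
      IntegrableOn (fun t : ℝ => Complex.exp (-l * t) * B (T t.toNNReal x) y) (Set.Ioi 0) ∧
      B (R x) y = ∫ t in Set.Ioi (0 : ℝ), Complex.exp (-l * t) * B (T t.toNNReal x) y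

/-- The norm adjoint `φ ↦ φ ∘ T` of a bounded operator. -/
def adjointOperator (T : X →L[𝕜] X) : (X →L[𝕜] 𝕜) →ₗ[𝕜] (X →L[𝕜] 𝕜) where
  toFun φ := φ.comp T
  map_add' _ _ := rfl
  map_smul' _ _ := rfl

/-- A norm-continuous (that is, strongly continuous) semigroup of bounded operators on `X`. -/
structure IsNormContinuousSemigroup (T : ℝ≥0 → X →L[𝕜] X) : Prop where
  zero : T 0 = ContinuousLinearMap.id 𝕜 X
  add : ∀ t s, T (t + s) = (T t).comp (T s)
  continuous : ∀ x, Continuous fun t => T t x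

end Semigroups

/-! ### The strict topology on `C_b(E)` -/

section Strict

variable {E : Type*} [TopologicalSpace E]

/-- Bounded functions (not necessarily continuous) that vanish at infinity. -/
def boundedVanishingAtInfinity (E : Type*) [TopologicalSpace E] : Set (E → ℂ) :=
  {φ | (∃ C : ℝ, ∀ x, ‖φ x‖ ≤ C) ∧ ∀ ε > 0, ∃ K : Set E, IsCompact K ∧ ∀ x ∉ K, ‖φ x‖ ≤ ε}

/-- The seminorm `f ↦ ‖φ f‖_∞` on `C_b(E)`, for a bounded function `φ`
(see `strictSeminorm_apply`). -/
def strictSeminorm (φ : E → ℂ) : Seminorm ℂ (E →ᵇ ℂ) :=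
  ⨆ x : E, (φ x • (BoundedContinuousFunction.evalCLM ℂ x : (E →ᵇ ℂ) →L[ℂ] ℂ).toLinearMap).toSeminorm

theorem strictSeminorm_apply (φ : E → ℂ) {C : ℝ} (hφ : ∀ x, ‖φ x‖ ≤ C) (f : E →ᵇ ℂ) :
    strictSeminorm φ f = ⨆ x : E, ‖φ x * f x‖ := by
  unfold strictSeminorm
  rw [Seminorm.iSup_apply]
  · simp
  · refine Seminorm.bddAbove_range_iff.mpr fun g => ⟨C * ‖g‖, ?_⟩
    rintro _ ⟨x, rfl⟩
    have : ‖φ x‖ * ‖g x‖ ≤ C * ‖g‖ :=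
      mul_le_mul (hφ x) (g.norm_coe_le_norm x) (norm_nonneg _) ((norm_nonneg _).trans (hφ x))
    simpa using this

/-- The uniform structure of the strict topology `β₀` on `C_b(E)`. -/
@[reducible]
def strictUniformity (E : Type*) [TopologicalSpace E] : UniformSpace (E →ᵇ ℂ) :=
  seminormUniformity (strictSeminorm '' boundedVanishingAtInfinity E)

end Strict

/-! ### The space `M_0(E)` of bounded complex Radon measures and its pairing with `C_b(E)` -/

section Radon

variable {E : Type*} [TopologicalSpace E] [T2Space E] [MeasurableSpace E] [BorelSpace E]

theorem innerRegular_of_le {m n : Measure E} [IsFiniteMeasure n] [n.InnerRegular] (h : m ≤ n) :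
    m.InnerRegular := by
  have : IsFiniteMeasure m := isFiniteMeasure_of_le n h
  refine ⟨fun A hA r hr => ?_⟩
  obtain ⟨ε, hε, hrε⟩ : ∃ ε : ℝ≥0∞, ε ≠ 0 ∧ r + ε < m A := by
    obtain ⟨s, hrs, hs⟩ := exists_between hr
    exact ⟨s - r, (tsub_pos_of_lt hrs).ne', by rwa [add_tsub_cancel_of_le hrs.le]⟩
  obtain ⟨K, hKA, hK, hlt⟩ := hA.exists_isCompact_sdiff_lt (measure_ne_top n A) hε
  refine ⟨K, hKA, hK, ?_⟩
  by_contra hle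
  have h1 : m A ≤ m K + m (A \ K) := by
    rw [← measure_inter_add_sdiff A hK.measurableSet, Set.inter_eq_self_of_subset_right hKA]
  have h2 : m (A \ K) ≤ ε := (h _).trans hlt.le
  exact absurd (h1.trans (add_le_add (not_lt.mp hle) h2)) (not_le.mpr hrε)

/-- The bounded complex Radon measures: complex Borel measures whose total variation is a finite
measure that is inner regular with respect to compact sets. -/
def boundedRadonMeasures (E : Type*) [TopologicalSpace E] [T2Space E] [MeasurableSpace E]
    [BorelSpace E] : Submodule ℂ (ComplexMeasure E) where
  carrier := {m | IsFiniteMeasure m.variation ∧ m.variation.InnerRegular}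
  zero_mem' := by
    simp only [Set.mem_ofPred_eq, VectorMeasure.variation_zero]
    exact ⟨inferInstance, inferInstance⟩
  add_mem' := by
    rintro m n ⟨_, _⟩ ⟨_, _⟩
    exact ⟨isFiniteMeasure_of_le _ VectorMeasure.variation_add_le,
      innerRegular_of_le VectorMeasure.variation_add_le⟩
  smul_mem' := by
    rintro c m ⟨_, _⟩
    simp only [Set.mem_ofPred_eq, VectorMeasure.variation_smul]
    exact ⟨inferInstance, inferInstance⟩

/-- The space `M_0(E)`. -/
abbrev RadonSpace (E : Type*) [TopologicalSpace E] [T2Space E] [MeasurableSpace E]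
    [BorelSpace E] : Type _ :=
  boundedRadonMeasures E

instance (m : RadonSpace E) : IsFiniteMeasure m.1.variation := m.2.1

/-- The total variation norm `‖m‖ = |m|(E)`. -/
instance : Norm (RadonSpace E) := ⟨fun m => m.1.variation.real Set.univ⟩

theorem radonSpace_norm_def (m : RadonSpace E) : ‖m‖ = m.1.variation.real Set.univ := rfl

theorem radonSpace_core : NormedSpace.Core ℂ (RadonSpace E) where
  norm_nonneg _ := ENNReal.toReal_nonneg
  norm_smul c m := by
    simp [radonSpace_norm_def, Measure.real, VectorMeasure.variation_smul]
  norm_triangle m n := by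
    have h := (VectorMeasure.variation_add_le (μ := m.1) (ν := n.1)) Set.univ
    have := ENNReal.toReal_mono (by finiteness) h
    rwa [Measure.add_apply, ENNReal.toReal_add (by finiteness) (by finiteness)] at this
  norm_eq_zero_iff m := by
    rw [radonSpace_norm_def, Measure.real, ENNReal.toReal_eq_zero_iff]
    simp only [measure_ne_top, or_false, Measure.measure_univ_eq_zero,
      VectorMeasure.variation_eq_zero, ZeroMemClass.coe_eq_zero]

instance : NormedAddCommGroup (RadonSpace E) := NormedAddCommGroup.ofCore radonSpace_core

instance : NormedSpace ℂ (RadonSpace E) := NormedSpace.ofCore radonSpace_core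

/-- The integral `∫ f dm` of a complex function against a complex measure. -/
def complexIntegral (m : ComplexMeasure E) (f : E → ℂ) : ℂ :=
  VectorMeasure.integral m f (ContinuousLinearMap.mul ℝ ℂ)

theorem integrable_radonSpace (m : RadonSpace E) (f : E →ᵇ ℂ) : m.1.Integrable f :=
  f.integrable m.1.variation

theorem complexIntegral_smul_measure (c : ℂ) (m : RadonSpace E) (f : E →ᵇ ℂ) :
    complexIntegral (c • m.1) f = c * complexIntegral m.1 f := by
  rcases eq_or_ne c 0 with rfl | hc0
  · have h0 : (0 : ℂ) • m.1 = 0 := zero_smul ℂ m.1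
    rw [h0, zero_mul]
    exact VectorMeasure.integral_zero_vectorMeasure
  have hvar : (c • m.1).variation = ‖c‖₊ • m.1.variation := VectorMeasure.variation_smul
  have hT := dominatedFinMeasAdditive_cbmApplyMeasure m.1 (ContinuousLinearMap.mul ℝ ℂ)
  have hc := dominatedFinMeasAdditive_cbmApplyMeasure (c • m.1) (ContinuousLinearMap.mul ℝ ℂ)
  refine Integrable.induction (μ := m.1.variation) (fun g : E → ℂ =>
    complexIntegral (c • m.1) g = c * complexIntegral m.1 g) ?_ ?_ ?_ ?_
    (integrable_radonSpace m f)
  · intro a s hs hfin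
    have h1 := setToFun_indicator_const hT hs hfin.ne a
    have h2 := setToFun_indicator_const hc hs (measure_ne_top _ s) a
    simp only [complexIntegral, VectorMeasure.integral]
    rw [h1, h2]
    simp [VectorMeasure.transpose]
    ring
  · intro g h _ hg hh ihg ihh
    have hg' : (c • m.1).Integrable g := by
      rw [VectorMeasure.Integrable, hvar]; exact hg.smul_measure_nnreal
    have hh' : (c • m.1).Integrable h := by
      rw [VectorMeasure.Integrable, hvar]; exact hh.smul_measure_nnreal
    have e1 := VectorMeasure.integral_add (B := ContinuousLinearMap.mul ℝ ℂ) hg' hh'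
    have e2 := VectorMeasure.integral_add (μ := m.1) (B := ContinuousLinearMap.mul ℝ ℂ) hg hh
    change complexIntegral (c • m.1) (g + h) = complexIntegral (c • m.1) g +
      complexIntegral (c • m.1) h at e1
    change complexIntegral m.1 (g + h) = complexIntegral m.1 g + complexIntegral m.1 h at e2
    rw [e1, e2, ihg, ihh, mul_add]
  · refine isClosed_eq ?_ (continuous_const.mul ?_)
    · have hle : (c • m.1).variation ≤ (‖c‖₊ : ℝ≥0∞) • m.1.variation := hvar.le
      have heq : ∀ g : E →₁[m.1.variation] ℂ, complexIntegral (c • m.1) g =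
          setToFun (c • m.1).variation _ hc
            ((Integrable.of_measure_le_smul (by simp) hle (L1.integrable_coeFn g)).toL1 g) :=
        fun g => setToFun_congr_ae hc (Integrable.coeFn_toL1 _).symm
      simp_rw [heq]
      exact (continuous_setToFun hc).comp (continuous_L1_toL1 _ (by simp) hle)
    · exact continuous_setToFun hT
  · intro g h hgh _ ih
    have hgh' : g =ᵐ[(c • m.1).variation] h := by
      rw [hvar]; exact (Measure.smul_absolutelyContinuous (c := (‖c‖₊ : ℝ≥0∞))).ae_le hgh
    have e1 := VectorMeasure.integral_congr_ae (B := ContinuousLinearMap.mul ℝ ℂ) hgh'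
    have e2 := VectorMeasure.integral_congr_ae (B := ContinuousLinearMap.mul ℝ ℂ) hgh
    simp only [complexIntegral] at ih ⊢
    rw [← e1, ← e2, ih]

/-- The pairing `⟨m, f⟩ = ∫ f dm` between `M_0(E)` and `C_b(E)`. -/
def radonPairing (E : Type*) [TopologicalSpace E] [T2Space E] [MeasurableSpace E]
    [BorelSpace E] : RadonSpace E →ₗ[ℂ] (E →ᵇ ℂ) →ₗ[ℂ] ℂ :=
  LinearMap.mk₂ ℂ (fun m f => complexIntegral m.1 f)
    (fun m n f => VectorMeasure.integral_add_vectorMeasure (integrable_radonSpace m f)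
      (integrable_radonSpace n f))
    (fun c m f => complexIntegral_smul_measure c m f)
    (fun m f g => VectorMeasure.integral_add (integrable_radonSpace m f)
      (integrable_radonSpace m g))
    (fun c m f => setToFun_smul _ (fun c s x => by
      simp [VectorMeasure.transpose]
      ring) c f)

end Radon

end

/-!
The general statement rests on Krein's theorem for the Mackey topology. If `μ(Y, X)` is
quasicomplete, then every `σ(Y, X)`-compact set in `Y` is contained in an absolutely convex one
(`exists_mackeySet_range_subset`). Given a `μ(X, Y)`-continuous semigroup `T` of type `(M, ω)` and
an absolutely convex compact set `K ⊆ Y`, the map `(t, y) ↦ e^{-αt} T(t)' y` with `α > ω` is weakly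
continuous on `[0, ∞) × K`, because `T(s) x → T(t) x` uniformly on `K`, and it extends by `0` to the
compact space `[0, ∞] × K`. Its image is therefore compact, and if `K'` is an absolutely convex
compact set around it, then `p_K (e^{-αt} T(t) x) ≤ p_{K'} x` for all `t`
(`isQuasiEquicontinuous_of_isQuasicomplete`).

Krein's theorem: let `D` be compact, let `ι : D → Y` be weakly continuous, and let `Φ` be a point of
the closed absolutely convex hull of `ι D` in the space of all functions on `X`. Then `Φ` is the
barycenter of a measure on a compact space (`exists_measure_of_mem_closure_convexHull`), so on an
absolutely convex compact set `L ⊆ X` it is an integral of a separately continuous function. Such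
integrals are continuous, since closures in the topology of pointwise convergence can be reached by
sequences (`exists_seq_tendsto_of_mem_closure`) and dominated convergence applies. By the minimax
theorem, a pointwise approximation of a continuous functional on `L` by a convex set can be made
uniform (`exists_forall_norm_sub_lt`). So `Φ` is the limit of a bounded `μ(Y, X)`-Cauchy filter and
is represented by a point of `Y`.

For adjoint semigroups, `μ(X, X*)` is the norm topology, which gives one implication. Conversely,
the means `h⁻¹ ∫₀ʰ T(s)* φ ds` have norm continuous orbits and converge weak-* to `φ` as `h → 0`. By
the minimax argument, the functionals with norm continuous orbits are Mackey dense, and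
equicontinuity passes the continuity of orbits on to all functionals
(`hasContinuousOrbits_adjoint`).

For Radon measures it remains to see that completeness of the strict topology `β₀` makes
`μ(C_b(E), M_0(E))` quasicomplete. Radon measures are `β₀`-continuous functionals
(`exists_norm_radonPairing_le`), and `β₀` is coarser than the Mackey topology
(`exists_strictSeminorm_le`), since a sequence of compact sets `K n` defines an absolutely convex
weakly compact set of measures that contains `2⁻ⁿ δ_x` for all `x ∈ K n`. So a Mackey-Cauchy filter
has a strict limit, and this is its Mackey limit as well (`isQuasicomplete_mackey_radonPairing`).
-/

namespace DualPair

open Set Filter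

/-! ### Seminorm uniformities and weak topologies -/

section Basics

variable {𝕜 : Type*} [RCLike 𝕜] {X : Type*} [AddCommGroup X] [Module 𝕜 X]
  {Y : Type*} [AddCommGroup Y] [Module 𝕜 Y]

theorem isUniformAddGroup_seminormUniformity (P : Set (Seminorm 𝕜 X)) :
    @IsUniformAddGroup X (seminormUniformity P) _ := by
  unfold seminormUniformity
  rw [iInf_subtype']
  exact isUniformAddGroup_iInf fun p =>
    @SeminormedAddCommGroup.to_isUniformAddGroup X p.1.toSeminormedAddCommGroup

theorem withSeminorms_seminormUniformity (P : Set (Seminorm 𝕜 X)) :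
    @WithSeminorms 𝕜 X P _ _ _ (fun p => p.1) (seminormUniformity P).toTopologicalSpace := by
  let _ := seminormUniformity P
  have := isUniformAddGroup_seminormUniformity P
  refine (SeminormFamily.withSeminorms_iff_uniformSpace_eq_iInf (fun p : P => p.1)).2 ?_
  exact iInf_subtype'

theorem continuous_of_mem_seminorms {P : Set (Seminorm 𝕜 X)} {p : Seminorm 𝕜 X} (hp : p ∈ P) :
    Continuous[(seminormUniformity P).toTopologicalSpace, inferInstance] p :=
  let _ := seminormUniformity P
  (withSeminorms_seminormUniformity P).continuous_seminorm ⟨p, hp⟩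

theorem cauchy_seminormUniformity_iff {P : Set (Seminorm 𝕜 X)} {f : Filter X} :
    @Cauchy X (seminormUniformity P) f ↔ f.NeBot ∧
      ∀ p ∈ P, ∀ ε > 0, ∃ A ∈ f, ∀ x ∈ A, ∀ y ∈ A, p (x - y) < ε := by
  refine and_congr_right fun _ => ?_
  rw [iInf_uniformity]
  simp_rw [iInf_uniformity, le_iInf_iff]
  refine forall₂_congr fun p _ => ?_
  let _ := p.toSeminormedAddCommGroup
  rw [(Metric.uniformity_basis_dist).ge_iff]
  refine forall₂_congr fun ε hε => ?_
  rw [Filter.mem_prod_same_iff]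
  refine exists_congr fun A => and_congr_right fun _ => ?_
  rw [prod_subset_iff]
  simp only [mem_ofPred_eq, dist_eq_norm_sub]
  rfl

theorem tendsto_seminormUniformity_iff {P : Set (Seminorm 𝕜 X)} {ι : Type*} {f : Filter ι}
    {u : ι → X} {x : X} :
    Tendsto u f (@nhds X (seminormUniformity P).toTopologicalSpace x) ↔
      ∀ p ∈ P, ∀ ε > 0, ∀ᶠ i in f, p (u i - x) < ε := by
  let _ := seminormUniformity P
  rw [(withSeminorms_seminormUniformity P).tendsto_nhds u x]
  exact ⟨fun h p hp => h ⟨p, hp⟩, fun h p => h p.1 p.2⟩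

theorem continuous_weakTopology_eval (B : X →ₗ[𝕜] Y →ₗ[𝕜] 𝕜) (y : Y) :
    Continuous[weakTopology B, inferInstance] fun x => B x y :=
  let _ := weakTopology B
  (continuous_apply y).comp (continuous_induced_dom (f := fun x y => B x y))

theorem continuous_weakTopology_rng (B : X →ₗ[𝕜] Y →ₗ[𝕜] 𝕜) {Z : Type*} [TopologicalSpace Z]
    {g : Z → X} (h : ∀ y, Continuous fun z => B (g z) y) :
    Continuous[inferInstance, weakTopology B] g :=
  continuous_induced_rng.2 (continuous_pi h)

/-- Compactness for the weak topology `σ(X, Y)`. -/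
abbrev IsWeaklyCompact (B : X →ₗ[𝕜] Y →ₗ[𝕜] 𝕜) (K : Set X) : Prop :=
  @IsCompact X (weakTopology B) K

theorem isWeaklyCompact_iff (B : X →ₗ[𝕜] Y →ₗ[𝕜] 𝕜) (K : Set X) :
    IsWeaklyCompact B K ↔ IsCompact ((fun x y => B x y) '' K) :=
  let _ := weakTopology B
  (IsInducing.mk rfl : IsInducing fun x y => B x y).isCompact_iff

end Basics

/-! ### Absolutely convex compact sets and the Mackey topology -/

section Mackey

variable {𝕜 : Type*} [RCLike 𝕜] {X : Type*} [AddCommGroup X] [Module 𝕜 X]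
  {Y : Type*} [AddCommGroup Y] [Module 𝕜 Y]

/-- The absolutely convex `σ(Y, X)`-compact subsets of `Y`, on which the Mackey topology of `X`
is the topology of uniform convergence. -/
def mackeySets (B : X →ₗ[𝕜] Y →ₗ[𝕜] 𝕜) : Set (Set Y) :=
  {K | IsAbsolutelyConvex 𝕜 K ∧ IsWeaklyCompact B.flip K}

theorem _root_.IsAbsolutelyConvex.smul_mem {K : Set Y} (hK : IsAbsolutelyConvex 𝕜 K) {y : Y}
    (hy : y ∈ K) {a : 𝕜} (ha : ‖a‖ ≤ 1) : a • y ∈ K := by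
  simpa using hK y hy y hy a 0 (by simpa using ha)

theorem _root_.IsAbsolutelyConvex.zero_mem {K : Set Y} (hK : IsAbsolutelyConvex 𝕜 K)
    (hne : K.Nonempty) : (0 : Y) ∈ K := by
  obtain ⟨y, hy⟩ := hne
  simpa using hK.smul_mem hy (a := 0) (by simp)

open scoped Pointwise in
theorem _root_.IsAbsolutelyConvex.add {K L : Set Y} (hK : IsAbsolutelyConvex 𝕜 K)
    (hL : IsAbsolutelyConvex 𝕜 L) : IsAbsolutelyConvex 𝕜 (K + L) := by
  rintro _ ⟨y, hy, z, hz, rfl⟩ _ ⟨y', hy', z', hz', rfl⟩ a b hab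
  refine ⟨_, hK y hy y' hy' a b hab, _, hL z hz z' hz' a b hab, ?_⟩
  simp only [smul_add]
  abel

variable (B : X →ₗ[𝕜] Y →ₗ[𝕜] 𝕜)

theorem norm_le_pairingSeminorm {K : Set Y} (hK : IsWeaklyCompact B.flip K) {y : Y}
    (hy : y ∈ K) (x : X) : ‖B x y‖ ≤ pairingSeminorm B K x := by
  rw [pairingSeminorm_apply B K (bddAbove_pairing_of_isCompact B hK)]
  exact le_ciSup (bddAbove_pairing_of_isCompact B hK x) (⟨y, hy⟩ : K)

theorem pairingSeminorm_le {K : Set Y} (hK : IsWeaklyCompact B.flip K) {x : X} {c : ℝ}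
    (hc : 0 ≤ c) (h : ∀ y ∈ K, ‖B x y‖ ≤ c) : pairingSeminorm B K x ≤ c := by
  rw [pairingSeminorm_apply B K (bddAbove_pairing_of_isCompact B hK)]
  exact Real.iSup_le (fun y => h y y.2) hc

theorem pairingSeminorm_mono {K L : Set Y} (hK : IsWeaklyCompact B.flip K)
    (hL : IsWeaklyCompact B.flip L) (h : K ⊆ L) :
    pairingSeminorm B K ≤ pairingSeminorm B L := fun x =>
  pairingSeminorm_le B hK (apply_nonneg _ x) fun _ hy => norm_le_pairingSeminorm B hL (h hy) x

theorem zero_mem_mackeySets : ({0} : Set Y) ∈ mackeySets B := by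
  let _ := weakTopology B.flip
  refine ⟨?_, isCompact_singleton⟩
  rintro _ rfl _ rfl a b -
  simp

theorem exists_mem_mackeySets (y : Y) : ∃ K ∈ mackeySets B, y ∈ K := by
  let _ := weakTopology B.flip
  refine ⟨(fun a : 𝕜 => a • y) '' Metric.closedBall 0 1, ⟨?_, ?_⟩, 1, by simp, one_smul _ _⟩
  · rintro _ ⟨c, hc, rfl⟩ _ ⟨d, hd, rfl⟩ a b hab
    refine ⟨a * c + b * d, ?_, by simp [add_smul, mul_smul]⟩
    rw [mem_closedBall_zero_iff] at *
    calc ‖a * c + b * d‖ ≤ ‖a‖ * ‖c‖ + ‖b‖ * ‖d‖ := by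
          simpa using norm_add_le (a * c) (b * d)
      _ ≤ ‖a‖ * 1 + ‖b‖ * 1 := by gcongr
      _ ≤ 1 := by simpa using hab
  · refine (isCompact_closedBall (0 : 𝕜) 1).image (continuous_weakTopology_rng B.flip fun x => ?_)
    simp only [map_smul]
    exact continuous_id.mul continuous_const

open scoped Pointwise in
theorem exists_superset_mem_mackeySets {K L : Set Y} (hK : K ∈ mackeySets B)
    (hL : L ∈ mackeySets B) : ∃ M ∈ mackeySets B, K ⊆ M ∧ L ⊆ M := by
  let _ := weakTopology B.flip
  rcases K.eq_empty_or_nonempty with rfl | hKne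
  · exact ⟨L, hL, empty_subset _, subset_rfl⟩
  rcases L.eq_empty_or_nonempty with rfl | hLne
  · exact ⟨K, hK, subset_rfl, empty_subset _⟩
  refine ⟨K + L, ⟨hK.1.add hL.1, ?_⟩,
    fun y hy => ⟨y, hy, 0, hL.1.zero_mem hLne, add_zero y⟩,
    fun y hy => ⟨0, hK.1.zero_mem hKne, y, hy, zero_add y⟩⟩
  rw [← add_image_prod]
  refine (hK.2.prod hL.2).image (continuous_weakTopology_rng B.flip fun x => ?_)
  simp only [map_add, LinearMap.add_apply]
  have h := continuous_weakTopology_eval B.flip x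
  exact (h.comp continuous_fst).add (h.comp continuous_snd)

theorem exists_finset_superset_mem_mackeySets
    (s : Finset (pairingSeminorm B '' mackeySets B)) :
    ∃ K ∈ mackeySets B, s.sup (fun p => p.1) ≤ pairingSeminorm B K := by
  classical
  induction s using Finset.induction_on with
  | empty => exact ⟨_, zero_mem_mackeySets B, by simp⟩
  | insert p s _ ih =>
    obtain ⟨K, hK, hsK⟩ := ih
    obtain ⟨_, L, hL, rfl⟩ := p
    obtain ⟨M, hM, hKM, hLM⟩ := exists_superset_mem_mackeySets B hK hL
    refine ⟨M, hM, ?_⟩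
    rw [Finset.sup_insert]
    exact sup_le (pairingSeminorm_mono B hL.2 hM.2 hLM)
      (hsK.trans (pairingSeminorm_mono B hK.2 hM.2 hKM))

theorem continuous_pairingSeminorm {K : Set Y} (hK : K ∈ mackeySets B) :
    Continuous[mackeyTopology B, inferInstance] (pairingSeminorm B K) :=
  continuous_of_mem_seminorms (mem_image_of_mem _ hK)

/-- A `μ(X, Y)`-continuous seminorm is dominated by a multiple of a single `p_K`, since the sets
`K` are directed. -/
theorem exists_le_pairingSeminorm {q : Seminorm 𝕜 X}
    (hq : Continuous[mackeyTopology B, inferInstance] q) :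
    ∃ K ∈ mackeySets B, ∃ C : ℝ≥0, q ≤ C • pairingSeminorm B K := by
  obtain ⟨s, C, -, h⟩ := @Seminorm.bound_of_continuous _ _ _ _ _ _ _ (mackeyTopology B)
    (withSeminorms_seminormUniformity (pairingSeminorm B '' mackeySets B)) q hq
  obtain ⟨K, hK, hs⟩ := exists_finset_superset_mem_mackeySets B s
  refine ⟨K, hK, C, h.trans fun x => ?_⟩
  have := hs x
  simp only [smul_apply]
  gcongr

theorem cauchy_mackey_iff {f : Filter X} :
    @Cauchy X (mackeyUniformity B) f ↔ f.NeBot ∧ ∀ K ∈ mackeySets B, ∀ ε > 0,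
      ∃ A ∈ f, ∀ x ∈ A, ∀ y ∈ A, pairingSeminorm B K (x - y) < ε := by
  refine cauchy_seminormUniformity_iff.trans ?_
  rw [forall_mem_image]
  rfl

theorem tendsto_mackey_iff {ι : Type*} {f : Filter ι} {u : ι → X} {x : X} :
    Tendsto u f (@nhds X (mackeyTopology B) x) ↔
      ∀ K ∈ mackeySets B, ∀ ε > 0, ∀ᶠ i in f, pairingSeminorm B K (u i - x) < ε := by
  refine tendsto_seminormUniformity_iff.trans ?_
  rw [forall_mem_image]
  rfl

theorem continuous_mackeyTopology_eval (y : Y) :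
    Continuous[mackeyTopology B, inferInstance] fun x => B x y := by
  let _ := mackeyTopology B
  obtain ⟨K, hK, hy⟩ := exists_mem_mackeySets B y
  refine continuous_iff_continuousAt.2 fun x => Metric.tendsto_nhds.2 fun ε hε => ?_
  filter_upwards [(tendsto_mackey_iff B).1 (tendsto_id (x := 𝓝 x)) K hK ε hε] with z hz
  rw [dist_eq_norm, ← LinearMap.sub_apply, ← map_sub]
  exact (norm_le_pairingSeminorm B hK.2 hy _).trans_lt hz

/-- An absolutely convex weakly compact set on which each element of `S` is bounded is uniformly
bounded on `S`. Some set `{x ∈ L | ∀ y ∈ S, |⟨x, y⟩| ≤ n}` has an interior point `x₀` in `L` by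
Baire's theorem; it contains `(1 - s) x₀ + s x` for all `x ∈ L`, if `s > 0` is small enough. -/
theorem exists_bound_of_isCompact {L : Set X} (hL : IsAbsolutelyConvex 𝕜 L)
    (hLc : IsWeaklyCompact B L) {S : Set Y}
    (hS : ∀ x ∈ L, ∃ C : ℝ, ∀ y ∈ S, ‖B x y‖ ≤ C) :
    ∃ C : ℝ, ∀ x ∈ L, ∀ y ∈ S, ‖B x y‖ ≤ C := by
  let _ := weakTopology B
  rcases L.eq_empty_or_nonempty with rfl | hne
  · exact ⟨0, by simp⟩
  have : Nonempty L := hne.to_subtype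
  have : CompactSpace L := isCompact_iff_compactSpace.1 hLc
  have hind : IsInducing fun (x : X) (y : Y) => B x y := ⟨rfl⟩
  have : RegularSpace X := hind.regularSpace
  have hev : ∀ y, Continuous fun x : L => B x y := fun y =>
    (continuous_weakTopology_eval B y).comp continuous_subtype_val
  obtain ⟨n, x₀, hx₀⟩ := nonempty_interior_of_iUnion_of_closed
    (f := fun n : ℕ => {x : L | ∀ y ∈ S, ‖B x y‖ ≤ n})
    (fun n => by
      simp only [ofPred_forall]
      exact isClosed_iInter fun y => isClosed_iInter fun _ =>
        isClosed_le (hev y).norm continuous_const)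
    (eq_univ_of_forall fun x => by
      obtain ⟨C, hC⟩ := hS x x.2
      obtain ⟨n, hn⟩ := exists_nat_ge C
      exact mem_iUnion.2 ⟨n, fun y hy => (hC y hy).trans hn⟩)
  let g : unitInterval × L → L := fun z =>
    ⟨((1 - z.1.1 : ℝ) : 𝕜) • x₀.1 + ((z.1.1 : ℝ) : 𝕜) • z.2.1, by
      refine hL _ x₀.2 _ z.2.2 _ _ ?_
      rw [RCLike.norm_ofReal, RCLike.norm_ofReal, abs_of_nonneg z.1.2.1,
        abs_of_nonneg (sub_nonneg.2 z.1.2.2)]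
      linarith⟩
  have hg : Continuous g := by
    refine Continuous.subtype_mk (continuous_weakTopology_rng B fun y => ?_) _
    simp only [map_add, map_smul, LinearMap.add_apply, LinearMap.smul_apply]
    have := (hev y).comp (continuous_snd (X := unitInterval) (Y := L))
    have h1 : Continuous fun z : unitInterval × L => z.1.1 :=
      continuous_subtype_val.comp continuous_fst
    have h2 : Continuous fun z : unitInterval × L => ((1 - z.1.1 : ℝ) : 𝕜) :=
      RCLike.continuous_ofReal.comp (continuous_const.sub h1)
    have h3 : Continuous fun z : unitInterval × L => (z.1.1 : 𝕜) :=
      RCLike.continuous_ofReal.comp h1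
    exact (h2.smul continuous_const).add (h3.smul this)
  -- `g` maps `{0} × L` to `x₀`, so by compactness of `L` it maps `{s} × L` near `x₀` for small `s`.
  obtain ⟨u, v, hu, -, h0u, huniv, huv⟩ := generalized_tube_lemma
    (isCompact_singleton (x := (0 : unitInterval))) (isCompact_univ (X := L))
    (isOpen_interior.preimage hg) (by
      rintro ⟨s, x⟩ ⟨rfl, -⟩
      have : g (0, x) = x₀ := Subtype.ext (by simp [g])
      rwa [mem_preimage, this])
  obtain ⟨ε, hε, hball⟩ := Metric.isOpen_iff.1 hu 0 (h0u rfl)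
  obtain ⟨s, hs0, hsε⟩ := exists_between (lt_min hε one_pos)
  let s' : unitInterval := ⟨s, hs0.le, (hsε.trans_le (min_le_right _ _)).le⟩
  have hs' : s' ∈ u := hball (by
    rw [Metric.mem_ball, Subtype.dist_eq, Real.dist_eq]
    simpa [s', abs_of_pos hs0] using hsε.trans_le (min_le_left _ _))
  refine ⟨2 * n / s, fun x hx y hy => ?_⟩
  have h1 : ‖B (g (s', ⟨x, hx⟩)) y‖ ≤ n := interior_subset (huv ⟨hs', huniv (mem_univ _)⟩) y hy
  have h2 : ‖B x₀.1 y‖ ≤ n := interior_subset hx₀ y hy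
  have h3 : (s : 𝕜) * B x y = B (g (s', ⟨x, hx⟩)) y - ((1 - s : ℝ) : 𝕜) * B x₀.1 y := by
    simp [g, s', RCLike.real_smul_eq_coe_mul]
  have h4 : s * ‖B x y‖ ≤ n + 1 * n := by
    calc s * ‖B x y‖ = ‖(s : 𝕜) * B x y‖ := by
          rw [norm_mul, RCLike.norm_ofReal, abs_of_pos hs0]
      _ ≤ ‖B (g (s', ⟨x, hx⟩)) y‖ + ‖((1 - s : ℝ) : 𝕜) * B x₀.1 y‖ := h3 ▸ norm_sub_le _ _
      _ ≤ n + 1 * n := by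
          rw [norm_mul, RCLike.norm_ofReal]
          have : |1 - s| ≤ 1 := abs_le.2 ⟨by linarith [s'.2.2], by linarith⟩
          gcongr
  rw [le_div_iff₀ hs0]
  linarith

end Mackey

/-! ### Uniform approximation on compact sets by the minimax theorem -/

/-- A convex set of continuous quasiconvex functions on a compact convex set `K` that has, at each
point of `K`, members above `-ε` has a member that is above `-ε` on all of `K`. -/
theorem exists_mem_convex_forall_ge {E : Type*} [AddCommGroup E] [Module ℝ E] [TopologicalSpace E]
    [IsTopologicalAddGroup E] [ContinuousSMul ℝ E] {K : Set E} (hne : K.Nonempty)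
    (hKc : Convex ℝ K) (hK : IsCompact K) {H : Set (E → ℝ)} (hH : Convex ℝ H)
    (hcont : ∀ h ∈ H, ContinuousOn h K) (hconv : ∀ h ∈ H, QuasiconvexOn ℝ K h)
    (hpt : ∀ x ∈ K, ∀ ε > 0, ∃ h ∈ H, -ε < h x) {ε : ℝ} (hε : 0 < ε) :
    ∃ h ∈ H, ∀ x ∈ K, -ε < h x := by
  -- The minimax theorem, in `EReal` since the suprema and infima may be infinite.
  have key := Sion.minimax' (f := fun (x : E) (h : E → ℝ) => ((h x : ℝ) : EReal)) hne hKc hK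
    (fun h hh => (continuous_coe_real_ereal.comp_continuousOn (hcont h hh)).lowerSemicontinuousOn)
    (fun h hh => (hconv h hh).monotone_comp (g := Real.toEReal) EReal.coe_strictMono.monotone) hH
    (fun x _ => (continuous_coe_real_ereal.comp
      (continuous_apply x)).upperSemicontinuous.upperSemicontinuousOn _)
    (fun x _ => by
      have : QuasiconcaveOn ℝ H fun h : E → ℝ => h x :=
        ((LinearMap.proj x : (E → ℝ) →ₗ[ℝ] ℝ).concaveOn hH).quasiconcaveOn
      exact this.monotone_comp (g := Real.toEReal) EReal.coe_strictMono.monotone)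
  have hlt : ((-ε : ℝ) : EReal) < ⨆ h ∈ H, ⨅ x ∈ K, ((h x : ℝ) : EReal) := by
    rw [← key]
    refine (EReal.coe_lt_coe_iff.2 (show -ε < -(ε / 2) by linarith)).trans_le ?_
    refine le_iInf₂ fun x hx => ?_
    obtain ⟨h, hh, hlt⟩ := hpt x hx (ε / 2) (by linarith)
    exact (EReal.coe_le_coe_iff.2 hlt.le).trans
      (le_iSup₂ (f := fun (h : E → ℝ) (_ : h ∈ H) => ((h x : ℝ) : EReal)) h hh)
  obtain ⟨h, hlt⟩ := lt_iSup_iff.1 hlt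
  obtain ⟨hh, hlt⟩ := lt_iSup_iff.1 hlt
  exact ⟨h, hh, fun x hx => EReal.coe_lt_coe_iff.1 (hlt.trans_le (iInf₂_le x hx))⟩

section Approximation

variable {𝕜 : Type*} [RCLike 𝕜] {X : Type*} [AddCommGroup X] [Module 𝕜 X]
  {Y : Type*} [AddCommGroup Y] [Module 𝕜 Y]

/-- If a linear functional `Φ` is weakly continuous on an absolutely convex weakly compact set `K`
and belongs to the pointwise closure of a convex set `H ⊆ Y` on `K`, then it belongs to the
uniform closure of `H` on `K`. -/
theorem exists_forall_norm_sub_lt (B : X →ₗ[𝕜] Y →ₗ[𝕜] 𝕜) {K : Set X}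
    (hK : IsAbsolutelyConvex 𝕜 K) (hKc : IsWeaklyCompact B K) (hne : K.Nonempty) {Φ : X →ₗ[𝕜] 𝕜}
    (hΦ : @ContinuousOn X 𝕜 (weakTopology B) _ Φ K) {H : Set Y}
    (hH : ∀ y ∈ H, ∀ z ∈ H, ∀ s t : ℝ, 0 ≤ s → 0 ≤ t → s + t = 1 →
      (s : 𝕜) • y + (t : 𝕜) • z ∈ H)
    (happ : ∀ x ∈ K, ∀ ε > 0, ∃ y ∈ H, ‖Φ x - B x y‖ < ε) {ε : ℝ} (hε : 0 < ε) :
    ∃ y ∈ H, ∀ x ∈ K, ‖Φ x - B x y‖ < ε := by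
  let _ : TopologicalSpace X := weakTopology B
  let _ : Module ℝ X := Module.compHom X (algebraMap ℝ 𝕜)
  have hsmul : ∀ (r : ℝ) (x : X), r • x = (r : 𝕜) • x := fun r x => by
    change (algebraMap ℝ 𝕜 r) • x = _
    rfl
  have : IsTopologicalAddGroup X :=
    inferInstanceAs (IsTopologicalAddGroup (WeakBilin B))
  have : ContinuousSMul ℝ X := by
    refine ⟨continuous_weakTopology_rng B fun y => ?_⟩
    simp only [hsmul, map_smul, LinearMap.smul_apply]
    have h1 : Continuous fun z : ℝ × X => (z.1 : 𝕜) :=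
      RCLike.continuous_ofReal.comp continuous_fst
    exact h1.smul ((continuous_weakTopology_eval B y).comp continuous_snd)
  have hKconv : Convex ℝ K := by
    intro x hx z hz a b ha hb hab
    rw [hsmul, hsmul]
    refine hK x hx z hz _ _ ?_
    rw [RCLike.norm_ofReal, RCLike.norm_ofReal, abs_of_nonneg ha, abs_of_nonneg hb, hab]
  let ψ : Y → X → ℝ := fun y x => RCLike.re (Φ x - B x y)
  have hψadd : ∀ y x z (a b : ℝ), ψ y (a • x + b • z) = a * ψ y x + b * ψ y z := by
    intro y x z a b
    simp only [ψ, hsmul, map_add, map_smul, LinearMap.add_apply, LinearMap.smul_apply, map_sub,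
      smul_eq_mul, RCLike.re_ofReal_mul]
    ring
  obtain ⟨_, ⟨y, hy, rfl⟩, hlt⟩ := exists_mem_convex_forall_ge hne hKconv hKc (H := ψ '' H)
    (by
      rintro _ ⟨y, hy, rfl⟩ _ ⟨z, hz, rfl⟩ a b ha hb hab
      refine ⟨_, hH y hy z hz a b ha hb hab, funext fun x => ?_⟩
      have : Φ x - (B x) ((a : 𝕜) • y + (b : 𝕜) • z) =
          (a : 𝕜) * (Φ x - B x y) + (b : 𝕜) * (Φ x - B x z) := by
        have h1 : (a : 𝕜) + b = 1 := by exact_mod_cast hab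
        simp only [map_add, map_smul, smul_eq_mul]
        linear_combination (-Φ x) * h1
      change RCLike.re (Φ x - B x ((a : 𝕜) • y + (b : 𝕜) • z)) = _
      rw [this, map_add, RCLike.re_ofReal_mul, RCLike.re_ofReal_mul]
      rfl)
    (by
      rintro _ ⟨y, hy, rfl⟩
      exact RCLike.continuous_re.comp_continuousOn
        (hΦ.sub (continuous_weakTopology_eval B y).continuousOn))
    (by
      rintro _ ⟨y, hy, rfl⟩
      refine ConvexOn.quasiconvexOn ⟨hKconv, fun x hx z hz a b ha hb hab => ?_⟩
      rw [hψadd]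
      rfl)
    (fun x hx δ hδ => by
      obtain ⟨y, hy, hlt⟩ := happ x hx δ hδ
      exact ⟨_, mem_image_of_mem _ hy, (abs_lt.1 ((RCLike.abs_re_le_norm _).trans_lt hlt)).1⟩)
    (half_pos hε)
  refine ⟨y, hy, fun x hx => ?_⟩
  -- The one-sided bound on real parts, applied at `-c • x`, bounds the norm, as `K` is balanced.
  obtain ⟨c, hc, hc'⟩ := RCLike.exists_norm_eq_mul_self (Φ x - B x y)
  have h1 := hlt _ (hK.smul_mem hx (a := -c) (by simp [hc]))
  have h2 : ψ y (-c • x) = -‖Φ x - B x y‖ := by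
    simp only [ψ, map_smul, LinearMap.smul_apply, smul_eq_mul]
    rw [← mul_sub, neg_mul, ← hc']
    simp
  rw [h2] at h1
  linarith

end Approximation

/-! ### Separately continuous functions on products of compact spaces -/

section SeparatelyContinuous

variable {𝕜 : Type*} [RCLike 𝕜] {L D : Type*} [TopologicalSpace L] [CompactSpace L]
  [TopologicalSpace D] [CompactSpace D] {f : L → D → 𝕜}

/-- For a separately continuous function on a product of compact spaces, a point `x₀` in the
closure of `A` is approximated by a *sequence* in `A`, in the sense of pointwise convergence of the
functions `f(x, ·)`.

The sequence `u` is chosen along with increasing finite sets `t n ⊆ D` such that `f(u n, ·)` is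
close to `f(x₀, ·)` on `t (n + 1)` and `t (n + 1)` approximates each `d ∈ D` up to `1 / (n + 1)` for
the functions `f(x₀, ·), f(u 0, ·), …, f(u (n - 1), ·)`. A point `d` then has the same values as a
cluster point `d'` of approximations in `⋃ t n`, and this forces `f(x, ·) = f(x₀, ·)` for all
cluster points `x` of `u`. -/
theorem exists_seq_tendsto_of_mem_closure (h₁ : ∀ x, Continuous (f x))
    (h₂ : ∀ d, Continuous fun x => f x d) {x₀ : L} {A : Set L} (hx₀ : x₀ ∈ closure A) :
    ∃ u : ℕ → L, (∀ n, u n ∈ A) ∧ ∀ d, Tendsto (fun n => f (u n) d) atTop (𝓝 (f x₀ d)) := by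
  classical
  have hF : ∀ (s : Finset L) (k : ℕ), ∃ t : Finset D, ∀ d, ∃ d' ∈ t, ∀ x ∈ s,
      dist (f x d) (f x d') < 1 / ((k : ℝ) + 1) := by
    intro s k
    obtain ⟨t, -, ht⟩ := isCompact_univ.elim_nhds_subcover
      (fun d' : D => {d | ∀ x ∈ s, dist (f x d) (f x d') < 1 / ((k : ℝ) + 1)})
      (fun d' _ => (s.eventually_all).2 fun x _ =>
        (h₁ x).continuousAt.eventually (Metric.ball_mem_nhds _ Nat.one_div_pos_of_nat))
    exact ⟨t, fun d => by simpa using ht (mem_univ d)⟩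
  have hN : ∀ (t : Finset D) (k : ℕ), ∃ x ∈ A, ∀ d ∈ t,
      dist (f x d) (f x₀ d) < 1 / ((k : ℝ) + 1) := by
    intro t k
    have : {x | ∀ d ∈ t, dist (f x d) (f x₀ d) < 1 / ((k : ℝ) + 1)} ∈ 𝓝 x₀ :=
      (t.eventually_all).2 fun d _ =>
        (h₂ d).continuousAt.eventually (Metric.ball_mem_nhds _ Nat.one_div_pos_of_nat)
    obtain ⟨x, hx, hxA⟩ := mem_closure_iff_nhds.1 hx₀ _ this
    exact ⟨x, hxA, hx⟩
  choose F hF using hF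
  choose N hNA hN using hN
  let S : ℕ → Finset L × Finset D := fun n => Nat.rec ({x₀}, ∅)
    (fun k p => (insert (N (p.2 ∪ F p.1 k) k) p.1, p.2 ∪ F p.1 k)) n
  let u : ℕ → L := fun n => N (S (n + 1)).2 n
  have hS1 : ∀ n, (S (n + 1)).1 = insert (u n) (S n).1 := fun n => rfl
  have hS2 : ∀ n, (S (n + 1)).2 = (S n).2 ∪ F (S n).1 n := fun n => rfl
  have hmono1 : Monotone fun n => (S n).1 := monotone_nat_of_le_succ fun n => by
    rw [hS1]; exact Finset.subset_insert _ _
  have hmono2 : Monotone fun n => (S n).2 := monotone_nat_of_le_succ fun n => by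
    rw [hS2]; exact Finset.subset_union_left
  have hone : Tendsto (fun k : ℕ => 1 / ((k : ℝ) + 1)) atTop (𝓝 0) :=
    tendsto_one_div_add_atTop_nhds_zero_nat
  have hcluster : ∀ (U : Ultrafilter ℕ) (x : L), (U : Filter ℕ) ≤ atTop → Tendsto u U (𝓝 x) →
      ∀ d, f x d = f x₀ d := by
    intro U x hU hux d
    choose a ha ha' using fun k => hF (S k).1 k d
    obtain ⟨d', -, hd'⟩ := isCompact_univ.ultrafilter_le_nhds (U.map a) (by simp)
    have hsame : ∀ k, ∀ z ∈ (S k).1, f z d = f z d' := by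
      intro k z hz
      refine tendsto_nhds_unique (f := fun i => f z (a i)) (l := (U : Filter ℕ)) ?_
        ((h₁ z).continuousAt.tendsto.comp hd')
      refine tendsto_iff_dist_tendsto_zero.2 (squeeze_zero' (.of_forall fun _ => dist_nonneg) ?_
        (hone.mono_left hU))
      filter_upwards [hU (eventually_ge_atTop k)] with i hi
      rw [dist_comm]
      exact (ha' i z (hmono1 hi hz)).le
    have hu : ∀ e, Tendsto (fun i => f (u i) e) U (𝓝 (f x e)) := fun e =>
      (h₂ e).continuousAt.tendsto.comp hux
    have e1 : f x d = f x d' := by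
      refine tendsto_nhds_unique (hu d) ((hu d').congr fun i => (hsame (i + 1) _ ?_).symm)
      rw [hS1]
      exact Finset.mem_insert_self _ _
    have e2 : ∀ k, f x (a k) = f x₀ (a k) := by
      intro k
      refine tendsto_nhds_unique (hu (a k)) (tendsto_iff_dist_tendsto_zero.2
        (squeeze_zero' (.of_forall fun _ => dist_nonneg) ?_ (hone.mono_left hU)))
      filter_upwards [hU (eventually_ge_atTop k)] with i hi
      refine (hN (S (i + 1)).2 i (a k) (hmono2 (Nat.succ_le_succ hi) ?_)).le
      change a k ∈ (S (k + 1)).2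
      rw [hS2]
      exact Finset.mem_union_right _ (ha k)
    have e3 : f x d' = f x₀ d' :=
      tendsto_nhds_unique ((h₁ x).continuousAt.tendsto.comp hd')
        (((h₁ x₀).continuousAt.tendsto.comp hd').congr fun k => (e2 k).symm)
    rw [e1, e3, hsame 0 x₀ (Finset.mem_singleton_self _)]
  refine ⟨u, fun n => hNA _ _, fun d => tendsto_iff_ultrafilter _ _ _ |>.2 fun U hU => ?_⟩
  obtain ⟨x, -, hx⟩ := isCompact_univ.ultrafilter_le_nhds (U.map u) (by simp)
  have := (h₂ d).continuousAt.tendsto.comp hx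
  rw [hcluster U x hU hx d] at this
  exact this

/-- Integrating a bounded separately continuous function on a product of compact spaces in one
variable gives a continuous function of the other. -/
theorem continuous_integral_of_separately_continuous [MeasurableSpace D] [BorelSpace D]
    (m : Measure D) [IsFiniteMeasure m] (h₁ : ∀ x, Continuous (f x))
    (h₂ : ∀ d, Continuous fun x => f x d) {C : ℝ} (hC : ∀ x d, ‖f x d‖ ≤ C) :
    Continuous fun x => ∫ d, f x d ∂m := by
  refine continuous_iff_continuousAt.2 fun x₀ => ?_
  by_contra hcon
  rw [ContinuousAt, Metric.tendsto_nhds] at hcon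
  push Not at hcon
  obtain ⟨ε, hε, hfreq⟩ := hcon
  obtain ⟨u, huA, hu⟩ := exists_seq_tendsto_of_mem_closure h₁ h₂
    (mem_closure_iff_frequently.2 hfreq)
  have hlim : Tendsto (fun n => ∫ d, f (u n) d ∂m) atTop (𝓝 (∫ d, f x₀ d ∂m)) :=
    tendsto_integral_of_dominated_convergence (fun _ => C)
      (fun n => (h₁ (u n)).aestronglyMeasurable) (integrable_const C)
      (fun n => .of_forall fun d => hC _ d) (.of_forall hu)
  obtain ⟨n, hn⟩ := ((Metric.tendsto_nhds.1 hlim) ε hε).exists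
  exact absurd hn (not_lt.2 (huA n))

end SeparatelyContinuous

/-! ### Barycenters -/

section Barycenter

variable {D : Type*} [TopologicalSpace D] [CompactSpace D]

/-- The state space of `C(D)`: normalized positive functionals in the dual unit ball, with the
weak-* topology. -/
def stateSpace (D : Type*) [TopologicalSpace D] [CompactSpace D] : Set (WeakDual ℝ C(D, ℝ)) :=
  WeakDual.toStrongDual ⁻¹' Metric.closedBall 0 1 ∩
    {Λ | (∀ g : C(D, ℝ), 0 ≤ g → 0 ≤ Λ g) ∧ Λ 1 = 1}

theorem isCompact_stateSpace : IsCompact (stateSpace D) := by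
  refine (WeakDual.isCompact_closedBall 0 1).inter_right ?_
  simp only [ofPred_and, ofPred_forall]
  refine IsClosed.inter (isClosed_iInter fun g => isClosed_iInter fun _ =>
    isClosed_le continuous_const (WeakDual.eval_continuous g))
    (isClosed_eq (WeakDual.eval_continuous _) continuous_const)

theorem convex_stateSpace : Convex ℝ (stateSpace D) := by
  rintro Λ ⟨hΛ', hΛ, hΛ1⟩ Γ ⟨hΓ', hΓ, hΓ1⟩ a b ha hb hab
  refine ⟨convex_closedBall (0 : StrongDual ℝ C(D, ℝ)) 1 hΛ' hΓ' ha hb hab, fun g hg => ?_, ?_⟩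
  · exact add_nonneg (mul_nonneg ha (hΛ g hg)) (mul_nonneg hb (hΓ g hg))
  · change a * Λ 1 + b * Γ 1 = 1
    rw [hΛ1, hΓ1, mul_one, mul_one, hab]

theorem exists_mem_stateSpace_eval (d : D) : ∃ Λ ∈ stateSpace D, ∀ g : C(D, ℝ), Λ g = g d := by
  refine ⟨StrongDual.toWeakDual (ContinuousMap.evalCLM ℝ d), ⟨?_, fun g hg => hg d, rfl⟩,
    fun g => rfl⟩
  have h : (ContinuousMap.evalCLM ℝ d : StrongDual ℝ C(D, ℝ)) ∈ Metric.closedBall 0 1 := by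
    refine (mem_closedBall_zero_iff (E := StrongDual ℝ C(D, ℝ))).2 ?_
    refine ContinuousLinearMap.opNorm_le_bound _ zero_le_one fun g => ?_
    rw [one_mul]
    exact g.norm_coe_le_norm d
  exact h

/-- States are integrals against regular measures (Riesz–Markov–Kakutani). -/
theorem exists_measure_of_mem_stateSpace [T2Space D] [MeasurableSpace D] [BorelSpace D]
    {Λ : WeakDual ℝ C(D, ℝ)} (hΛ : Λ ∈ stateSpace D) :
    ∃ m : Measure D, IsFiniteMeasure m ∧ m.Regular ∧ ∀ g : C(D, ℝ), Λ g = ∫ d, g d ∂m := by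
  let Γ : CompactlySupportedContinuousMap D ℝ →ₚ[ℝ] ℝ :=
  { toFun g := Λ g.toContinuousMap
    map_add' g g' := map_add Λ _ _
    map_smul' c g := map_smul Λ _ _
    monotone' g g' hgg' := by
      have := hΛ.2.1 (g'.toContinuousMap - g.toContinuousMap) (sub_nonneg.2 hgg')
      rw [map_sub] at this
      exact sub_nonneg.1 this }
  refine ⟨RealRMK.rieszMeasure Γ, inferInstance, inferInstance, fun g => ?_⟩
  exact (RealRMK.integral_rieszMeasure Γ
    ⟨g, HasCompactSupport.of_compactSpace _⟩).symm

/-- The points of the closed convex hull of a compact set, in a space of functions, are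
barycenters of measures: they form a subset of the image of the compact convex state space. -/
theorem exists_measure_of_mem_closure_convexHull {𝕜 : Type*} [RCLike 𝕜] {X : Type*} [T2Space D]
    [MeasurableSpace D] [BorelSpace D] {ι : D → X → 𝕜} (hι : Continuous ι) {Φ : X → 𝕜}
    (hΦ : Φ ∈ closure (convexHull ℝ (range ι))) :
    ∃ m : Measure D, IsFiniteMeasure m ∧ m.Regular ∧ ∀ x, Φ x = ∫ d, ι d x ∂m := by
  have hιx : ∀ x, Continuous fun d => ι d x := fun x => (continuous_apply x).comp hι
  let re : X → C(D, ℝ) := fun x => ⟨fun d => RCLike.re (ι d x), RCLike.continuous_re.comp (hιx x)⟩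
  let im : X → C(D, ℝ) := fun x => ⟨fun d => RCLike.im (ι d x), RCLike.continuous_im.comp (hιx x)⟩
  let Ψ : WeakDual ℝ C(D, ℝ) → X → 𝕜 := fun Λ x => (Λ (re x) : 𝕜) + (Λ (im x) : 𝕜) * RCLike.I
  have hΨ : Continuous Ψ := continuous_pi fun x =>
    (RCLike.continuous_ofReal.comp (WeakDual.eval_continuous _)).add
      ((RCLike.continuous_ofReal.comp (WeakDual.eval_continuous _)).mul continuous_const)
  have hlin : IsLinearMap ℝ Ψ := by
    refine ⟨fun Λ Γ => funext fun x => ?_, fun c Λ => funext fun x => ?_⟩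
    · change (((Λ (re x) + Γ (re x) : ℝ)) : 𝕜) + ((Λ (im x) + Γ (im x) : ℝ) : 𝕜) * RCLike.I =
        ((Λ (re x) : 𝕜) + (Λ (im x) : 𝕜) * RCLike.I) + ((Γ (re x) : 𝕜) + (Γ (im x) : 𝕜) * RCLike.I)
      push_cast
      ring
    · change (((c * Λ (re x) : ℝ)) : 𝕜) + ((c * Λ (im x) : ℝ) : 𝕜) * RCLike.I =
        c • ((Λ (re x) : 𝕜) + (Λ (im x) : 𝕜) * RCLike.I)
      rw [RCLike.real_smul_eq_coe_mul]
      push_cast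
      ring
  have hsub : closure (convexHull ℝ (range ι)) ⊆ Ψ '' stateSpace D := by
    refine closure_minimal (convexHull_min ?_ (convex_stateSpace.is_linear_image hlin))
      (isCompact_stateSpace.image hΨ).isClosed
    rintro _ ⟨d, rfl⟩
    obtain ⟨Λ, hΛ, hΛd⟩ := exists_mem_stateSpace_eval d
    refine ⟨Λ, hΛ, funext fun x => ?_⟩
    simp only [Ψ, hΛd]
    exact RCLike.re_add_im _
  obtain ⟨Λ, hΛ, rfl⟩ := hsub hΦ
  obtain ⟨m, hm, hreg, hint⟩ := exists_measure_of_mem_stateSpace hΛ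
  refine ⟨m, hm, hreg, fun x => ?_⟩
  have hi : Integrable (fun d => ι d x) m :=
    (hιx x).integrable_of_hasCompactSupport (HasCompactSupport.of_compactSpace _)
  rw [← integral_re_add_im hi]
  simp only [Ψ, hint]
  rfl

end Barycenter

/-! ### Krein's theorem for the Mackey topology -/

section Krein

variable {𝕜 : Type*} [RCLike 𝕜]

theorem isAbsolutelyConvex_of_convex {X : Type*} {S : Set (X → 𝕜)} (hS : Convex ℝ S)
    (hbal : ∀ c : 𝕜, ‖c‖ ≤ 1 → ∀ g ∈ S, c • g ∈ S) : IsAbsolutelyConvex 𝕜 S := by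
  intro g hg h hh a b hab
  obtain ⟨u, hu, hu'⟩ : ∃ u : 𝕜, ‖u‖ = 1 ∧ a = ‖a‖ * u := by
    obtain ⟨u, hu, h⟩ := RCLike.exists_norm_mul_eq_self a
    exact ⟨u, hu, by rw [mul_comm, h]⟩
  obtain ⟨v, hv, hv'⟩ : ∃ u : 𝕜, ‖u‖ = 1 ∧ b = ‖b‖ * u := by
    obtain ⟨u, hu, h⟩ := RCLike.exists_norm_mul_eq_self b
    exact ⟨u, hu, by rw [mul_comm, h]⟩
  rcases (add_nonneg (norm_nonneg a) (norm_nonneg b)).eq_or_lt with h0 | h0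
  · have ha : a = 0 := norm_eq_zero.1 (by linarith [norm_nonneg a, norm_nonneg b])
    have hb : b = 0 := norm_eq_zero.1 (by linarith [norm_nonneg a, norm_nonneg b])
    simpa [ha, hb] using hbal 0 (by simp) g hg
  · have h1 := convex_iff_div.1 hS (hbal u hu.le g hg) (hbal v hv.le h hh) (norm_nonneg a)
      (norm_nonneg b) h0
    have h2 := hbal ((‖a‖ + ‖b‖ : ℝ) : 𝕜) (by
      rw [RCLike.norm_ofReal, abs_of_pos h0]; exact hab) _ h1
    convert h2 using 1
    ext x
    have h3 : ((‖a‖ : 𝕜) + (‖b‖ : 𝕜)) ≠ 0 := by exact_mod_cast h0.ne'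
    simp only [Pi.add_apply, Pi.smul_apply, smul_eq_mul, RCLike.real_smul_eq_coe_mul]
    push_cast
    field_simp
    linear_combination g x * hu' + h x * hv'

variable {X : Type*} [AddCommGroup X] [Module 𝕜 X] {Y : Type*} [AddCommGroup Y] [Module 𝕜 Y]
  {D : Type*}

/-- The closed convex hull, in the space of all functions on `X`, of a family of functionals
`⟨·, ι d⟩`. -/
def closedHull (B : X →ₗ[𝕜] Y →ₗ[𝕜] 𝕜) (ι : D → Y) : Set (X → 𝕜) :=
  closure (convexHull ℝ (range fun d x => B x (ι d)))

variable (B : X →ₗ[𝕜] Y →ₗ[𝕜] 𝕜) {ι : D → Y}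

theorem convex_range_pairing : Convex ℝ (range fun (y : Y) (x : X) => B x y) := by
  rintro _ ⟨y, rfl⟩ _ ⟨z, rfl⟩ a b - - -
  refine ⟨(a : 𝕜) • y + (b : 𝕜) • z, funext fun x => ?_⟩
  simp [RCLike.real_smul_eq_coe_mul]

theorem exists_linearMap_of_mem_closedHull {Φ : X → 𝕜} (hΦ : Φ ∈ closedHull B ι) :
    ∃ Φ' : X →ₗ[𝕜] 𝕜, ⇑Φ' = Φ := by
  have h : closedHull B ι ⊆ range ((↑) : (X →ₗ[𝕜] 𝕜) → X → 𝕜) := by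
    refine closure_minimal ((convexHull_min ?_ (convex_range_pairing B)).trans ?_)
      (LinearMap.isClosed_range_coe X 𝕜 (RingHom.id 𝕜))
    · rintro _ ⟨d, rfl⟩
      exact ⟨ι d, rfl⟩
    · rintro _ ⟨y, rfl⟩
      exact ⟨B.flip y, rfl⟩
  exact h hΦ

theorem norm_le_of_mem_closedHull {Φ : X → 𝕜} (hΦ : Φ ∈ closedHull B ι) {x : X} {C : ℝ}
    (hC : ∀ d, ‖B x (ι d)‖ ≤ C) : ‖Φ x‖ ≤ C := by
  have h : closedHull B ι ⊆ {g | ‖g x‖ ≤ C} := by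
    refine closure_minimal (convexHull_min ?_ ?_)
      (isClosed_le (continuous_apply x).norm continuous_const)
    · rintro _ ⟨d, rfl⟩
      exact hC d
    · have := (convex_closedBall (0 : 𝕜) C).linear_preimage
        (LinearMap.proj (R := ℝ) (φ := fun _ : X => 𝕜) x)
      convert this using 1
      ext g
      simp
  exact h hΦ

theorem smul_mem_closedHull (hbal : ∀ c : 𝕜, ‖c‖ ≤ 1 → ∀ d, ∃ d', ι d' = c • ι d) {c : 𝕜}
    (hc : ‖c‖ ≤ 1) {Φ : X → 𝕜} (hΦ : Φ ∈ closedHull B ι) : c • Φ ∈ closedHull B ι := by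
  refine map_mem_closure (continuous_const_smul c) hΦ fun g hg => ?_
  have : convexHull ℝ (range fun d x => B x (ι d)) ⊆
      {g : X → 𝕜 | c • g ∈ convexHull ℝ (range fun d x => B x (ι d))} := by
    refine convexHull_min ?_ fun g hg h hh a b ha hb hab => ?_
    · rintro _ ⟨d, rfl⟩
      obtain ⟨d', hd'⟩ := hbal c hc d
      refine subset_convexHull _ _ ⟨d', funext fun x => ?_⟩
      simp [hd']
    · have := convex_convexHull ℝ _ hg hh ha hb hab
      rw [mem_ofPred_eq, smul_add, smul_comm c a, smul_comm c b]
      exact this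
  exact this hg

variable [TopologicalSpace D]

theorem continuous_smul_pairing (hι : ∀ x, Continuous fun d => B x (ι d)) (x : X) :
    Continuous fun z : Metric.closedBall (0 : 𝕜) 1 × D => B x (z.1.1 • ι z.2) := by
  simp only [map_smul]
  exact (continuous_subtype_val.comp continuous_fst).smul ((hι x).comp continuous_snd)

variable [CompactSpace D]

theorem exists_bound_pairing (hι : ∀ x, Continuous fun d => B x (ι d)) {L : Set X}
    (hL : L ∈ mackeySets B.flip) : ∃ C : ℝ, ∀ x ∈ L, ∀ d, ‖B x (ι d)‖ ≤ C := by
  obtain ⟨C, hC⟩ := exists_bound_of_isCompact B hL.1 hL.2 (S := range ι) (fun x _ => by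
    obtain ⟨C, hC⟩ := (isCompact_range (hι x)).isBounded.exists_norm_le
    refine ⟨C, ?_⟩
    rintro _ ⟨d, rfl⟩
    exact hC _ (mem_range_self d))
  exact ⟨C, fun x hx d => hC x hx _ (mem_range_self d)⟩

theorem isCompact_closedHull (hι : ∀ x, Continuous fun d => B x (ι d)) :
    IsCompact (closedHull B ι) := by
  choose C hC using fun x => (isCompact_range (hι x)).isBounded.exists_norm_le
  refine (isCompact_univ_pi fun x => isCompact_closedBall (0 : 𝕜) (C x)).of_isClosed_subset
    isClosed_closure fun Φ hΦ x _ => ?_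
  exact mem_closedBall_zero_iff.2
    (norm_le_of_mem_closedHull B hΦ fun d => hC x _ (mem_range_self d))

/-- Points of the closed convex hull are barycenters, that is, integrals of the function
`(x, d) ↦ ⟨x, ι d⟩`, which is separately continuous on `L × D`. -/
theorem continuousOn_of_mem_closedHull [T2Space D] (hι : ∀ x, Continuous fun d => B x (ι d))
    {L : Set X} (hL : L ∈ mackeySets B.flip) {Φ : X → 𝕜} (hΦ : Φ ∈ closedHull B ι) :
    @ContinuousOn X 𝕜 (weakTopology B) _ Φ L := by
  let _ : TopologicalSpace X := weakTopology B
  borelize D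
  obtain ⟨m, hm, -, hint⟩ := exists_measure_of_mem_closure_convexHull
    (continuous_pi hι) hΦ
  obtain ⟨C, hC⟩ := exists_bound_pairing B hι hL
  have : CompactSpace L := isCompact_iff_compactSpace.1 hL.2
  rw [continuousOn_iff_continuous_domRestrict]
  have := continuous_integral_of_separately_continuous m (f := fun (x : L) d => B x (ι d))
    (fun x => hι x) (fun d => (continuous_weakTopology_eval B (ι d)).comp continuous_subtype_val)
    (C := C) (fun x d => hC x x.2 d)
  exact this.congr fun x => (hint x).symm

/-- If `μ(Y, X)` is quasicomplete, the points of the closed convex hull of a weakly compact set in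
the space of all functions on `X` are represented by points of `Y`. On the absolutely convex
compact subsets of `X`, such a point `Φ` is continuous and therefore a uniform limit of elements of
the convex hull. So `Φ` is the limit of a bounded Cauchy filter for the Mackey topology. -/
theorem closedHull_subset_range [T2Space D] (hq : IsQuasicomplete 𝕜 (mackeyUniformity B.flip))
    (hι : ∀ x, Continuous fun d => B x (ι d)) :
    closedHull B ι ⊆ range fun (y : Y) (x : X) => B x y := by
  intro Φ hΦ
  let S : Set Y := {y | (fun x => B x y) ∈ closedHull B ι}
  have happ : ∀ L ∈ mackeySets B.flip, (0 : X) ∈ L → ∀ ε > 0,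
      ∃ y ∈ S, ∀ x ∈ L, ‖Φ x - B x y‖ < ε := by
    intro L hL h0 ε hε
    obtain ⟨Φ', rfl⟩ := exists_linearMap_of_mem_closedHull B hΦ
    obtain ⟨y, hy, h⟩ := exists_forall_norm_sub_lt B hL.1 hL.2 ⟨0, h0⟩
      (continuousOn_of_mem_closedHull B hι hL hΦ)
      (H := {y | (fun x => B x y) ∈ convexHull ℝ (range fun d x => B x (ι d))})
      (fun y hy z hz s t hs ht hst => by
        have := convex_convexHull ℝ _ hy hz hs ht hst
        rw [mem_ofPred_eq]
        convert this using 1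
        ext x
        simp [RCLike.real_smul_eq_coe_mul])
      (fun x _ δ hδ => by
        have hopen : {g : X → 𝕜 | ‖Φ' x - g x‖ < δ} ∈ 𝓝 (⇑Φ') :=
          (isOpen_lt (continuous_const.sub (continuous_apply x)).norm continuous_const).mem_nhds
            (by simpa using hδ)
        obtain ⟨g, hg, hg'⟩ := mem_closure_iff_nhds.1 hΦ _ hopen
        obtain ⟨y, rfl⟩ : g ∈ range fun (y : Y) (x : X) => B x y := by
          refine convexHull_min ?_ (convex_range_pairing B) hg'
          rintro _ ⟨d, rfl⟩
          exact ⟨ι d, rfl⟩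
        exact ⟨y, hg', hg⟩) hε
    exact ⟨y, subset_closure hy, h⟩
  -- The filter generated by the uniform approximations of `Φ` that lie in `S`.
  let F : Filter Y :=
  { sets := {A | ∃ L ∈ mackeySets B.flip, (0 : X) ∈ L ∧ ∃ ε > 0,
      {y | y ∈ S ∧ ∀ x ∈ L, ‖Φ x - B x y‖ < ε} ⊆ A}
    univ_sets := ⟨{0}, zero_mem_mackeySets _, rfl, 1, one_pos, subset_univ _⟩
    sets_of_superset := by
      rintro A A' ⟨L, hL, h0, ε, hε, h⟩ hA
      exact ⟨L, hL, h0, ε, hε, h.trans hA⟩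
    inter_sets := by
      rintro A A' ⟨L, hL, h0, ε, hε, h⟩ ⟨L', hL', -, ε', hε', h'⟩
      obtain ⟨M, hM, hLM, hLM'⟩ := exists_superset_mem_mackeySets _ hL hL'
      refine ⟨M, hM, hLM h0, min ε ε', lt_min hε hε', fun y hy => ⟨h ⟨hy.1, fun x hx => ?_⟩,
        h' ⟨hy.1, fun x hx => ?_⟩⟩⟩
      · exact (hy.2 x (hLM hx)).trans_le (min_le_left _ _)
      · exact (hy.2 x (hLM' hx)).trans_le (min_le_right _ _) }
  have hF : ∀ L ∈ mackeySets B.flip, ∀ ε > 0,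
      ∀ᶠ y in F, y ∈ S ∧ ∀ x ∈ L, ‖Φ x - B x y‖ < ε := by
    intro L hL ε hε
    obtain ⟨M, hM, hLM, h0⟩ := exists_superset_mem_mackeySets _ hL (zero_mem_mackeySets B.flip)
    exact ⟨M, hM, h0 rfl, ε, hε, fun y hy => ⟨hy.1, fun x hx => hy.2 x (hLM hx)⟩⟩
  have hne : F.NeBot := by
    refine neBot_iff.2 fun hbot => ?_
    have : ∅ ∈ F := hbot ▸ mem_bot
    obtain ⟨L, hL, h0, ε, hε, h⟩ := this
    obtain ⟨y, hy⟩ := happ L hL h0 ε hε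
    exact h hy
  have hcauchy : @Cauchy Y (mackeyUniformity B.flip) F := by
    refine (cauchy_mackey_iff B.flip).2 ⟨hne, fun L hL ε hε => ⟨_, hF L hL (ε / 3) (by linarith),
      fun y hy z hz => ?_⟩⟩
    refine (pairingSeminorm_le B.flip hL.2 (c := ε / 3 + ε / 3) (by linarith)
      fun x hx => ?_).trans_lt (by linarith)
    have : B.flip (y - z) x = (Φ x - B x z) - (Φ x - B x y) := by simp
    rw [this]
    exact (norm_sub_le _ _).trans (add_le_add (hz.2 x hx).le (hy.2 x hx).le)
  have hclosed : @IsClosed Y (mackeyTopology B.flip) S := by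
    let _ := mackeyTopology B.flip
    exact isClosed_closure.preimage (continuous_pi fun x => continuous_mackeyTopology_eval B.flip x)
  have hbdd : @Bornology.IsVonNBounded 𝕜 Y _ _ _ (mackeyTopology B.flip) S := by
    refine (@WithSeminorms.isVonNBounded_iff_seminorm_bounded _ _ _ _ _ _ _
      (mackeyTopology B.flip) S (withSeminorms_seminormUniformity _)).2 ?_
    rintro ⟨_, L, hL, rfl⟩
    obtain ⟨C, hC⟩ := exists_bound_pairing B hι hL
    refine ⟨max C 0 + 1, by positivity, fun y hy => ?_⟩
    refine (pairingSeminorm_le B.flip hL.2 (le_max_right C 0) fun x hx => ?_).trans_lt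
      (lt_add_one _)
    exact (norm_le_of_mem_closedHull B hy (hC x hx)).trans (le_max_left _ _)
  obtain ⟨y, hy, hlim⟩ := hq S hbdd hclosed F hcauchy
    (le_principal_iff.2 ((hF _ (zero_mem_mackeySets _) 1 one_pos).mono fun _ h => h.1))
  refine ⟨y, funext fun x => ?_⟩
  have h1 : Tendsto (fun z => B x z) F (𝓝 (B x y)) := by
    let _ := mackeyTopology B.flip
    exact ((continuous_mackeyTopology_eval B.flip x).continuousAt (x := y)).tendsto.mono_left hlim
  have h2 : Tendsto (fun z => B x z) F (𝓝 (Φ x)) := by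
    obtain ⟨L, hL, hx⟩ := exists_mem_mackeySets B.flip x
    refine Metric.tendsto_nhds.2 fun ε hε => (hF L hL ε hε).mono fun z hz => ?_
    rw [dist_comm, dist_eq_norm]
    exact hz.2 x hx
  exact tendsto_nhds_unique h1 h2

/-- If the closed absolutely convex hull of a weakly compact set, formed in the space of all
functions on `X`, consists of points of `Y`, then it is an absolutely convex weakly compact set. -/
theorem exists_mackeySet_of_closedHull_subset (hι : ∀ x, Continuous fun d => B x (ι d))
    (hsub : closedHull B (fun z : Metric.closedBall (0 : 𝕜) 1 × D => z.1.1 • ι z.2) ⊆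
      range fun (y : Y) (x : X) => B x y) : ∃ K ∈ mackeySets B, range ι ⊆ K := by
  -- The multiplication by scalars of norm at most `1` makes the closed convex hull balanced.
  let ι' : Metric.closedBall (0 : 𝕜) 1 × D → Y := fun z => z.1.1 • ι z.2
  have hι' : ∀ x, Continuous fun z => B x (ι' z) := continuous_smul_pairing B hι
  have hbal : ∀ c : 𝕜, ‖c‖ ≤ 1 → ∀ z, ∃ z', ι' z' = c • ι' z := by
    rintro c hc ⟨⟨a, ha⟩, d⟩
    refine ⟨⟨⟨c * a, ?_⟩, d⟩, mul_smul _ _ _⟩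
    rw [mem_closedBall_zero_iff] at ha ⊢
    rw [norm_mul]
    exact mul_le_one₀ hc (norm_nonneg _) ha
  have habs : IsAbsolutelyConvex 𝕜 (closedHull B ι') :=
    isAbsolutelyConvex_of_convex (convex_convexHull ℝ _).closure
      fun c hc g hg => smul_mem_closedHull B hbal hc hg
  refine ⟨{y | (fun x => B x y) ∈ closedHull B ι'}, ⟨fun y hy z hz a b hab => ?_, ?_⟩, ?_⟩
  · have := habs _ hy _ hz a b hab
    rw [mem_ofPred_eq]
    convert this using 1
    ext x
    simp
  · refine (isWeaklyCompact_iff B.flip _).2 ?_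
    have h : (fun y x => B.flip y x) '' {y | (fun x => B x y) ∈ closedHull B ι'} =
        closedHull B ι' := image_preimage_eq_of_subset hsub
    rw [h]
    exact isCompact_closedHull B hι'
  · rintro _ ⟨d, rfl⟩
    refine subset_closure (subset_convexHull ℝ _ ⟨(⟨1, by simp⟩, d), ?_⟩)
    simp [ι']

/-- **Krein's theorem** for the Mackey topology: if `μ(Y, X)` is quasicomplete, then a weakly
compact set in `Y`, here the image of `ι`, is contained in an absolutely convex one. -/
theorem exists_mackeySet_range_subset [T2Space D]
    (hq : IsQuasicomplete 𝕜 (mackeyUniformity B.flip))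
    (hι : ∀ x, Continuous fun d => B x (ι d)) : ∃ K ∈ mackeySets B, range ι ⊆ K :=
  exists_mackeySet_of_closedHull_subset B hι
    (closedHull_subset_range B hq (continuous_smul_pairing B hι))

end Krein

/-! ### Equicontinuity of Mackey continuous semigroups -/

section Equicontinuity

variable {𝕜 : Type*} [RCLike 𝕜]

section Algebraic

variable {X : Type*} [AddCommGroup X] [Module 𝕜 X] {Y : Type*} [AddCommGroup Y] [Module 𝕜 Y]
  (B : X →ₗ[𝕜] Y →ₗ[𝕜] 𝕜)

/-- A `σ(X, Y)`-continuous operator has an adjoint on `Y`, as the weakly continuous functionals on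
`X` are given by points of `Y`. -/
theorem exists_adjoint {S : X →ₗ[𝕜] X} (hS : Continuous[weakTopology B, weakTopology B] S) :
    ∃ S' : Y → Y, ∀ x y, B (S x) y = B x (S' y) := by
  have h : ∀ y, ∃ z, ∀ x, B (S x) y = B x z := fun y => by
    let _ := weakTopology B
    let φ : StrongDual 𝕜 (WeakBilin B) :=
      ⟨B.flip y ∘ₗ S, (continuous_weakTopology_eval B y).comp hS⟩
    obtain ⟨z, hz⟩ := LinearMap.dualEmbedding_surjective B φ
    exact ⟨z, fun x => (DFunLike.congr_fun hz x).symm⟩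
  choose S' hS' using h
  exact ⟨S', fun x y => hS' y x⟩

theorem isEquicontinuousFamily_mackey {I : Type*} {S : I → X →ₗ[𝕜] X}
    (h : ∀ K ∈ mackeySets B, ∃ K' ∈ mackeySets B, ∀ i x,
      pairingSeminorm B K (S i x) ≤ pairingSeminorm B K' x) :
    IsEquicontinuousFamily (mackeyTopology B) S := by
  let _ := mackeyTopology B
  intro p hp
  obtain ⟨K, hK, C, hpC⟩ := exists_le_pairingSeminorm B hp
  obtain ⟨K', hK', h⟩ := h K hK
  refine ⟨C • pairingSeminorm B K', (continuous_pairingSeminorm B hK').const_smul C,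
    fun i x => (hpC _).trans ?_⟩
  simp only [smul_apply]
  gcongr
  exact h i x

end Algebraic

variable {X : Type*} [NormedAddCommGroup X] [NormedSpace 𝕜 X]
  {Y : Type*} [NormedAddCommGroup Y] [NormedSpace 𝕜 Y] {B : X →ₗ[𝕜] Y →ₗ[𝕜] 𝕜}

/-- Absolutely convex weakly compact sets are bounded in norm, as functionals on `X`. -/
theorem exists_bound_mackeySet (hB : ∀ x y, ‖B x y‖ ≤ ‖x‖ * ‖y‖) {K : Set Y}
    (hK : K ∈ mackeySets B) : ∃ C : ℝ, 0 ≤ C ∧ ∀ y ∈ K, ∀ x, ‖B x y‖ ≤ C * ‖x‖ := by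
  obtain ⟨C, hC⟩ := exists_bound_of_isCompact B.flip hK.1 hK.2 (S := {x : X | ‖x‖ ≤ 1})
    (fun y _ => ⟨‖y‖, fun x hx => (hB x y).trans (mul_le_of_le_one_left (norm_nonneg _) hx)⟩)
  refine ⟨max C 0, le_max_right _ _, fun y hy x => ?_⟩
  rcases eq_or_ne x 0 with rfl | hx
  · simp
  have hx' : ‖x‖ ≠ 0 := norm_ne_zero_iff.2 hx
  have h := hC y hy (((‖x‖⁻¹ : ℝ) : 𝕜) • x) (by
    rw [mem_ofPred_eq, norm_smul, RCLike.norm_ofReal, abs_of_nonneg (by positivity),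
      inv_mul_cancel₀ hx'])
  rw [map_smul, smul_eq_mul, norm_mul, RCLike.norm_ofReal, abs_of_nonneg (by positivity),
    inv_mul_le_iff₀ (by positivity), mul_comm] at h
  exact h.trans (by gcongr; exact le_max_left _ _)

/-- If the orbits of `T` are `μ(X, Y)`-continuous, then `(t, y) ↦ ⟨T(t) x, y⟩` is jointly
continuous on `[0, ∞) × K`, as `T(s) x → T(t) x` uniformly on `K`. -/
theorem continuous_orbit_pairing {T : ℝ≥0 → X →ₗ[𝕜] X}
    (hT : HasContinuousOrbits (mackeyTopology B) T) {K : Set Y} (hK : K ∈ mackeySets B) (x : X) :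
    let _ := weakTopology B.flip
    Continuous fun z : ℝ≥0 × K => B (T z.1 x) z.2 := by
  intro _
  refine continuous_iff_continuousAt.2 fun ⟨t, y⟩ => ?_
  have h1 : Tendsto (fun z : ℝ≥0 × K => B (T z.1 x - T t x) z.2) (𝓝 (t, y)) (𝓝 0) := by
    have h := (tendsto_mackey_iff B).1
      (@Continuous.tendsto ℝ≥0 X _ (mackeyTopology B) _ (hT x) t) K hK
    refine Metric.tendsto_nhds.2 fun ε hε => ?_
    filter_upwards [continuous_fst.continuousAt.eventually (h ε hε)] with z hz
    rw [dist_zero_right]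
    exact (norm_le_pairingSeminorm B hK.2 z.2.2 _).trans_lt hz
  have h2 : Tendsto (fun z : ℝ≥0 × K => B (T t x) z.2) (𝓝 (t, y)) (𝓝 (B (T t x) y)) :=
    ((continuous_weakTopology_eval B.flip (T t x)).comp
      (continuous_subtype_val.comp continuous_snd)).continuousAt
  have h3 := h1.add h2
  rw [zero_add] at h3
  refine h3.congr fun z => ?_
  simp

/-- A `μ(X, Y)`-continuous exponentially bounded semigroup is quasi-equicontinuous if `μ(Y, X)` is
quasicomplete. For `α` above the growth bound, `(t, y) ↦ e^{-αt} T(t)' y` extends continuously by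
`0` to `[0, ∞] × K`, and Krein's theorem applies to its image. -/
theorem isQuasiEquicontinuous_of_isQuasicomplete (hB : ∀ x y, ‖B x y‖ ≤ ‖x‖ * ‖y‖)
    (hsep : ∀ y, (∀ x, B x y = 0) → y = 0)
    (hq : IsQuasicomplete 𝕜 (mackeyUniformity B.flip)) {T : ℝ≥0 → X →ₗ[𝕜] X}
    (hTc : ∀ t, Continuous[weakTopology B, weakTopology B] (T t)) {M ω : ℝ}
    (hTb : ∀ t x, ‖T t x‖ ≤ M * Real.exp (ω * t) * ‖x‖)
    (hT : HasContinuousOrbits (mackeyTopology B) T) :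
    IsQuasiEquicontinuous (mackeyTopology B) T := by
  choose T' hT' using fun t => exists_adjoint B (hTc t)
  refine ⟨ω + 1, isEquicontinuousFamily_mackey B fun K hK => ?_⟩
  let _ : TopologicalSpace K :=
    @instTopologicalSpaceSubtype Y (fun y => y ∈ K) (weakTopology B.flip)
  have hev : ∀ x, Continuous fun y : K => B x y := fun x =>
    let _ := weakTopology B.flip
    (continuous_weakTopology_eval B.flip x).comp continuous_subtype_val
  have : CompactSpace K := @isCompact_iff_compactSpace _ (weakTopology B.flip) _ |>.1 hK.2
  have : T2Space K := by
    refine T2Space.of_injective_continuous (f := fun (y : K) (x : X) => B x y) ?_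
      (continuous_pi hev)
    intro y z h
    refine Subtype.ext (sub_eq_zero.1 (hsep _ fun x => ?_))
    rw [map_sub, sub_eq_zero]
    exact congrFun h x
  obtain ⟨C, hC0, hC⟩ := exists_bound_mackeySet hB hK
  let ι : ℝ≥0∞ × K → Y := fun z =>
    if z.1 = ∞ then 0 else ((Real.exp (-(ω + 1) * z.1.toNNReal) : ℝ) : 𝕜) • T' z.1.toNNReal z.2
  have hιcoe : ∀ (x : X) (t : ℝ≥0) (y : K), B x (ι (t, y)) =
      ((Real.exp (-(ω + 1) * t) : ℝ) : 𝕜) * B (T t x) y := fun x t y => by simp [ι, hT']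
  have hι : ∀ x, Continuous fun z => B x (ι z) := by
    intro x
    refine continuous_iff_continuousAt.2 fun ⟨t, y⟩ => ?_
    rcases eq_or_ne t ∞ with rfl | ht
    · have hlim : Tendsto (fun r : ℝ => C * (M * ‖x‖) * Real.exp (-r)) atTop (𝓝 0) := by
        simpa using (Real.tendsto_exp_neg_atTop_nhds_zero).const_mul (C * (M * ‖x‖))
      refine Metric.tendsto_nhds.2 fun ε hε => ?_
      obtain ⟨R, hR⟩ := (hlim.eventually (gt_mem_nhds hε)).exists_forall_of_atTop
      have hmem : {z : ℝ≥0∞ × K | ENNReal.ofReal R < z.1} ∈ 𝓝 ((∞ : ℝ≥0∞), y) :=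
        (isOpen_lt continuous_const continuous_fst).mem_nhds ENNReal.ofReal_lt_top
      filter_upwards [hmem] with z hz
      have h0 : B x (ι (∞, y)) = 0 := by simp [ι]
      rw [h0, dist_zero_right]
      obtain ⟨t, z⟩ := z
      induction t with
      | top => simpa [ι] using hε
      | coe t =>
        rw [hιcoe, norm_mul, RCLike.norm_ofReal, abs_of_pos (Real.exp_pos _)]
        refine lt_of_le_of_lt ?_ (hR t ?_)
        · calc Real.exp (-(ω + 1) * t) * ‖B (T t x) z‖
              ≤ Real.exp (-(ω + 1) * t) * (C * (M * Real.exp (ω * t) * ‖x‖)) := by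
                gcongr
                exact (hC z z.2 _).trans (by gcongr; exact hTb t x)
            _ = C * (M * ‖x‖) * (Real.exp (-(ω + 1) * t) * Real.exp (ω * t)) := by ring
            _ = C * (M * ‖x‖) * Real.exp (-t) := by
                rw [← Real.exp_add]
                ring_nf
        · exact (ENNReal.ofReal_le_iff_le_toReal ENNReal.coe_ne_top).1 (le_of_lt hz)
    · lift t to ℝ≥0 using ht
      have hemb : IsOpenEmbedding (Prod.map ((↑) : ℝ≥0 → ℝ≥0∞) (id : K → K)) :=
        ENNReal.isOpenEmbedding_coe.prodMap IsOpenEmbedding.id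
      refine (hemb.continuousAt_iff (x := (t, y))).1 (Continuous.continuousAt ?_)
      have hc : Continuous fun z : ℝ≥0 × K =>
          ((Real.exp (-(ω + 1) * z.1) : ℝ) : 𝕜) * B (T z.1 x) z.2 := by
        have h1 : Continuous fun z : ℝ≥0 × K => ((Real.exp (-(ω + 1) * z.1) : ℝ) : 𝕜) :=
          RCLike.continuous_ofReal.comp (by fun_prop)
        exact h1.mul (continuous_orbit_pairing hT hK x)
      exact hc.congr fun z => (hιcoe x z.1 z.2).symm
  obtain ⟨K', hK', hsub⟩ := exists_mackeySet_range_subset B hq hι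
  refine ⟨K', hK', fun t x => pairingSeminorm_le B hK.2 (apply_nonneg _ _) fun y hy => ?_⟩
  have h := norm_le_pairingSeminorm B hK'.2 (hsub (mem_range_self ((t : ℝ≥0∞), (⟨y, hy⟩ : K)))) x
  rw [hιcoe] at h
  rwa [LinearMap.smul_apply, map_smul, LinearMap.smul_apply, smul_eq_mul]

theorem norm_pairing_le {𝕜 : Type*} [RCLike 𝕜] {X : Type*} [NormedAddCommGroup X]
    [NormedSpace 𝕜 X] {Y : Type*} [NormedAddCommGroup Y] [NormedSpace 𝕜 Y]
    {B : X →ₗ[𝕜] Y →ₗ[𝕜] 𝕜} (hB : IsNormingDualPair B) (x : X) (y : Y) :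
    ‖B x y‖ ≤ ‖x‖ * ‖y‖ := by
  rcases eq_or_ne y 0 with rfl | hy
  · simp
  have hy0 : 0 < ‖y‖ := norm_pos_iff.2 hy
  have h := (hB.isLUB_left x).1 ⟨((‖y‖⁻¹ : ℝ) : 𝕜) • y, by
    rw [mem_ofPred_eq, norm_smul, RCLike.norm_ofReal, abs_of_pos (inv_pos.2 hy0),
      inv_mul_cancel₀ hy0.ne'], rfl⟩
  beta_reduce at h
  rw [map_smul, norm_smul, RCLike.norm_ofReal, abs_of_pos (inv_pos.2 hy0),
    inv_mul_le_iff₀ hy0] at h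
  rwa [mul_comm]

theorem eq_zero_of_forall_pairing_eq_zero {𝕜 : Type*} [RCLike 𝕜] {X : Type*}
    [NormedAddCommGroup X] [NormedSpace 𝕜 X] {Y : Type*} [NormedAddCommGroup Y] [NormedSpace 𝕜 Y]
    {B : X →ₗ[𝕜] Y →ₗ[𝕜] 𝕜} (hB : IsNormingDualPair B) {y : Y} (hy : ∀ x, B x y = 0) :
    y = 0 := by
  refine norm_le_zero_iff.1 ((hB.isLUB_right y).2 ?_)
  rintro _ ⟨x, -, rfl⟩
  simp [hy x]

end Equicontinuity

/-! ### Adjoint semigroups -/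

section Adjoint

variable {𝕜 : Type*} [RCLike 𝕜] {X : Type*} [NormedAddCommGroup X] [NormedSpace 𝕜 X]

theorem norm_topDualPairing_le (φ : X →L[𝕜] 𝕜) (x : X) :
    ‖topDualPairing 𝕜 X φ x‖ ≤ ‖φ‖ * ‖x‖ :=
  φ.le_opNorm x

theorem closedBall_mem_mackeySets :
    Metric.closedBall (0 : X →L[𝕜] 𝕜) 1 ∈ mackeySets (topDualPairing 𝕜 X).flip := by
  refine ⟨fun φ hφ ψ hψ a b hab => ?_, WeakDual.isCompact_closedBall (𝕜 := 𝕜) (E := X) 0 1⟩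
  rw [mem_closedBall_zero_iff] at *
  calc ‖a • φ + b • ψ‖ ≤ ‖a‖ * ‖φ‖ + ‖b‖ * ‖ψ‖ := by
        simpa [norm_smul] using norm_add_le (a • φ) (b • ψ)
    _ ≤ ‖a‖ * 1 + ‖b‖ * 1 := by gcongr
    _ ≤ 1 := by simpa using hab

/-- For a Banach space `X`, the Mackey topology `μ(X, X*)` is the norm topology, so it is
complete. -/
theorem isQuasicomplete_mackey_topDualPairing_flip [CompleteSpace X] :
    IsQuasicomplete 𝕜 (mackeyUniformity (topDualPairing 𝕜 X).flip) := by
  intro S _ hSc F hF hFS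
  obtain ⟨hne, hF⟩ := (cauchy_mackey_iff _).1 hF
  have hnorm : Cauchy F := by
    refine Metric.cauchy_iff.2 ⟨hne, fun ε hε => ?_⟩
    obtain ⟨A, hA, h⟩ := hF _ closedBall_mem_mackeySets ε hε
    refine ⟨A, hA, fun x hx y hy => ?_⟩
    obtain ⟨g, hg, hgx⟩ := exists_dual_vector'' 𝕜 (x - y)
    have h1 := norm_le_pairingSeminorm (topDualPairing 𝕜 X).flip
      closedBall_mem_mackeySets.2 (mem_closedBall_zero_iff.2 hg) (x - y)
    have h2 : (topDualPairing 𝕜 X).flip (x - y) g = (‖x - y‖ : 𝕜) := hgx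
    rw [h2, RCLike.norm_ofReal, abs_of_nonneg (norm_nonneg _)] at h1
    rw [dist_eq_norm]
    exact h1.trans_lt (h x hx y hy)
  obtain ⟨x, hx⟩ := CompleteSpace.complete hnorm
  have hlim : F ≤ @nhds X (mackeyTopology (topDualPairing 𝕜 X).flip) x := by
    refine (tendsto_mackey_iff (topDualPairing 𝕜 X).flip (u := id)).2 fun K hK ε hε => ?_
    obtain ⟨C, hC0, hC⟩ := exists_bound_mackeySet (B := (topDualPairing 𝕜 X).flip)
      (fun x φ => (norm_topDualPairing_le φ x).trans_eq (mul_comm _ _)) hK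
    have hball : Metric.ball x (ε / (C + 1)) ∈ F := hx (Metric.ball_mem_nhds _ (by positivity))
    filter_upwards [hball] with y hy
    rw [Metric.mem_ball, dist_eq_norm, lt_div_iff₀ (by positivity)] at hy
    refine (pairingSeminorm_le _ hK.2 (by positivity) fun φ hφ => hC φ hφ _).trans_lt ?_
    simp only [id]
    nlinarith [norm_nonneg (y - x)]
  let _ := mackeyTopology (topDualPairing 𝕜 X).flip
  exact ⟨x, hSc.mem_of_frequently_of_tendsto (Eventually.frequently (le_principal_iff.1 hFS))
    (tendsto_id'.2 hlim), hlim⟩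

/-- Strongly continuous semigroups are exponentially bounded. -/
theorem _root_.IsNormContinuousSemigroup.exists_norm_le [CompleteSpace X] {T : ℝ≥0 → X →L[𝕜] X}
    (hT : IsNormContinuousSemigroup T) :
    ∃ M ω : ℝ, 1 ≤ M ∧ ∀ t, ‖T t‖ ≤ M * Real.exp (ω * t) := by
  obtain ⟨C, hC⟩ := banach_steinhaus (g := fun t : Icc (0 : ℝ≥0) 1 => T t) (fun x => by
    obtain ⟨C, hC⟩ := (isCompact_Icc.image (hT.continuous x)).isBounded.exists_norm_le
    exact ⟨C, fun t => hC _ (mem_image_of_mem _ t.2)⟩)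
  let M := max C 1
  have hM1 : 1 ≤ M := le_max_right _ _
  have hM : ∀ t : ℝ≥0, t ≤ 1 → ‖T t‖ ≤ M := fun t ht =>
    (hC ⟨t, zero_le, ht⟩).trans (le_max_left _ _)
  have hn : ∀ (n : ℕ) (t : ℝ≥0), t ≤ 1 → ‖T (n + t)‖ ≤ M * M ^ n := by
    intro n
    induction n with
    | zero => intro t ht; simpa using hM t ht
    | succ n ih =>
      intro t ht
      have : ((n + 1 : ℕ) : ℝ≥0) + t = 1 + (n + t) := by push_cast; ring
      rw [this, hT.add]
      calc ‖(T 1).comp (T (n + t))‖ ≤ ‖T 1‖ * ‖T (n + t)‖ := ContinuousLinearMap.opNorm_comp_le _ _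
        _ ≤ M * (M * M ^ n) := by
          gcongr
          · exact hM 1 le_rfl
          · exact ih t ht
        _ = M * M ^ (n + 1) := by ring
  refine ⟨M, Real.log M, hM1, fun t => ?_⟩
  have ht : t = (⌊t⌋₊ : ℝ≥0) + (t - ⌊t⌋₊) := (add_tsub_cancel_of_le (Nat.floor_le zero_le)).symm
  have h1 : t - ⌊t⌋₊ ≤ 1 := by
    rw [tsub_le_iff_left]
    exact (Nat.lt_floor_add_one t).le
  have h2 := hn ⌊t⌋₊ _ h1
  rw [← ht] at h2
  refine h2.trans ?_
  gcongr
  rw [← Real.rpow_def_of_pos (by linarith), ← Real.rpow_natCast]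
  exact Real.rpow_le_rpow_of_exponent_le hM1 (by exact_mod_cast Nat.floor_le zero_le)

/-- The weak-* integral `a ↦ ∫₀ᵃ q(s) ds` of a weak-* continuous function with values in the dual
of a Banach space is norm continuous. -/
theorem exists_continuous_weakStar_integral [CompleteSpace X] {q : ℝ → X →L[𝕜] 𝕜}
    (hq : ∀ y, Continuous fun s => q s y) :
    ∃ Ψ : ℝ → X →L[𝕜] 𝕜, Continuous Ψ ∧ ∀ a y, Ψ a y = ∫ s in (0 : ℝ)..a, q s y := by
  have hb : ∀ R : ℝ, ∃ C, 0 ≤ C ∧ ∀ s, |s| ≤ R → ‖q s‖ ≤ C := by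
    intro R
    obtain ⟨C, hC⟩ := banach_steinhaus (g := fun s : Icc (-R) R => q s) (fun x => by
      obtain ⟨C, hC⟩ := (isCompact_Icc.image (hq x)).isBounded.exists_norm_le
      exact ⟨C, fun t => hC _ (mem_image_of_mem _ t.2)⟩)
    exact ⟨max C 0, le_max_right _ _, fun s hs => (hC ⟨s, abs_le.1 hs⟩).trans (le_max_left _ _)⟩
  have hint : ∀ y a b, IntervalIntegrable (fun s => q s y) volume a b := fun y a b =>
    (hq y).intervalIntegrable a b
  have hbound : ∀ (R C : ℝ), (∀ s, |s| ≤ R → ‖q s‖ ≤ C) → ∀ a b : ℝ, |a| ≤ R → |b| ≤ R → ∀ y,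
      ‖∫ s in a..b, q s y‖ ≤ C * |b - a| * ‖y‖ := by
    intro R C hC a b ha hb y
    refine (intervalIntegral.norm_integral_le_of_norm_le_const (C := C * ‖y‖)
      fun s hs => ?_).trans_eq (by ring)
    refine (q s).le_of_opNorm_le (hC s ?_) y
    rcases le_total a b with h | h
    · rw [uIoc_of_le h] at hs
      exact abs_le.2 ⟨by linarith [(abs_le.1 ha).1, hs.1], by linarith [(abs_le.1 hb).2, hs.2]⟩
    · rw [uIoc_of_ge h] at hs
      exact abs_le.2 ⟨by linarith [(abs_le.1 hb).1, hs.1], by linarith [(abs_le.1 ha).2, hs.2]⟩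
  choose C hC0 hC using hb
  let Ψ : ℝ → X →L[𝕜] 𝕜 := fun a => LinearMap.mkContinuous
    { toFun y := ∫ s in (0 : ℝ)..a, q s y
      map_add' y z := by
        simp only [map_add]
        exact intervalIntegral.integral_add (hint y 0 a) (hint z 0 a)
      map_smul' c y := by
        simp only [map_smul]
        exact intervalIntegral.integral_smul c _ }
    (C |a| * |a - 0|) (fun y => hbound |a| _ (hC _) 0 a (by simp) le_rfl y)
  refine ⟨Ψ, continuous_iff_continuousAt.2 fun a => ?_, fun a y => rfl⟩
  refine tendsto_iff_norm_sub_tendsto_zero.2 ?_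
  have hlim : Tendsto (fun b => C (|a| + 1) * |b - a|) (𝓝 a) (𝓝 0) := by
    have : Continuous fun b => C (|a| + 1) * |b - a| := by fun_prop
    simpa using this.tendsto a
  refine squeeze_zero' (.of_forall fun _ => norm_nonneg _) ?_ hlim
  filter_upwards [Metric.ball_mem_nhds a one_pos] with b hb
  rw [Metric.mem_ball, Real.dist_eq] at hb
  refine ContinuousLinearMap.opNorm_le_bound _ (mul_nonneg (hC0 _) (abs_nonneg _)) fun y => ?_
  have h1 : (Ψ b - Ψ a) y = ∫ s in a..b, q s y :=
    intervalIntegral.integral_interval_sub_left (hint y 0 b) (hint y 0 a)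
  rw [h1]
  refine hbound (|a| + 1) _ (hC _) a b (by linarith) ?_ y
  have := abs_add_le (b - a) a
  rw [sub_add_cancel] at this
  linarith

/-- Each functional is the weak-* limit of functionals with a norm continuous orbit under the
adjoint semigroup, namely of the means `h⁻¹ ∫₀ʰ T(s)* φ ds`. -/
theorem exists_norm_continuous_orbit_sub_lt [CompleteSpace X] {T : ℝ≥0 → X →L[𝕜] X}
    (hT : IsNormContinuousSemigroup T) (φ : X →L[𝕜] 𝕜) (x : X) {ε : ℝ} (hε : 0 < ε) :
    ∃ ψ : X →L[𝕜] 𝕜, (Continuous fun t => adjointOperator (T t) ψ) ∧ ‖φ x - ψ x‖ < ε := by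
  have hcont : ∀ y, Continuous fun s : ℝ => φ (T s.toNNReal y) := fun y =>
    φ.continuous.comp ((hT.continuous y).comp continuous_real_toNNReal)
  obtain ⟨Ψ, hΨ, hΨi⟩ := exists_continuous_weakStar_integral
    (q := fun s : ℝ => φ.comp (T s.toNNReal)) hcont
  have hΨT : ∀ (t : ℝ≥0) (h : ℝ), 0 ≤ h → adjointOperator (T t) (Ψ h) = Ψ (h + t) - Ψ t := by
    intro t h hh
    ext y
    have hi : ∀ a b : ℝ, IntervalIntegrable (fun s : ℝ => φ (T s.toNNReal y)) volume a b :=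
      fun a b => (hcont y).intervalIntegrable a b
    change Ψ h (T t y) = Ψ (h + t) y - Ψ t y
    rw [hΨi, hΨi, hΨi]
    simp only [ContinuousLinearMap.comp_apply]
    rw [intervalIntegral.integral_interval_sub_left (hi _ _) (hi _ _)]
    have e1 : ∫ s in (0 : ℝ)..h, φ (T s.toNNReal (T t y)) =
        ∫ s in (0 : ℝ)..h, φ (T (s + t).toNNReal y) := by
      refine intervalIntegral.integral_congr fun s hs => ?_
      rw [uIcc_of_le hh] at hs
      rw [Real.toNNReal_add hs.1 t.coe_nonneg, Real.toNNReal_coe, hT.add]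
      rfl
    rw [e1, intervalIntegral.integral_comp_add_right (fun s : ℝ => φ (T s.toNNReal y)), zero_add]
  -- `φ x` is the derivative at `0` of `h ↦ ∫₀ʰ φ (T(s) x) ds`.
  have hderiv : HasDerivAt (fun a => Ψ a x) (φ x) 0 := by
    have h := intervalIntegral.integral_hasDerivAt_right (a := (0 : ℝ)) (b := 0)
      ((hcont x).intervalIntegrable 0 0) (hcont x).stronglyMeasurable.stronglyMeasurableAtFilter
      (hcont x).continuousAt
    have h0 : φ (T (0 : ℝ).toNNReal x) = φ x := by simp [hT.zero]
    rw [h0] at h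
    simpa only [hΨi, ContinuousLinearMap.comp_apply] using h
  have hslope := hderiv.tendsto_slope_zero_right
  obtain ⟨h, hlt, hpos⟩ := ((Metric.tendsto_nhds.1 hslope ε hε).and self_mem_nhdsWithin).exists
  refine ⟨((h⁻¹ : ℝ) : 𝕜) • Ψ h, ?_, ?_⟩
  · simp only [map_smul, hΨT _ h (le_of_lt hpos)]
    have h1 : Continuous fun t : ℝ≥0 => Ψ (h + t) - Ψ t :=
      (hΨ.comp (by fun_prop)).sub (hΨ.comp (by fun_prop))
    exact (continuous_const_smul ((h⁻¹ : ℝ) : 𝕜)).comp h1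
  · rw [dist_comm, dist_eq_norm] at hlt
    have h0 : Ψ 0 x = 0 := by simp [hΨi]
    simpa [h0, RCLike.real_smul_eq_coe_mul] using hlt

/-- The adjoint semigroup is Mackey continuous as soon as it is quasi-equicontinuous: its orbits are
norm continuous on a subspace of `X*` that is weak-* dense and therefore Mackey dense. -/
theorem hasContinuousOrbits_adjoint [CompleteSpace X] {T : ℝ≥0 → X →L[𝕜] X}
    (hT : IsNormContinuousSemigroup T)
    (hqe : IsQuasiEquicontinuous (mackeyTopology (topDualPairing 𝕜 X))
      fun t => adjointOperator (T t)) :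
    HasContinuousOrbits (mackeyTopology (topDualPairing 𝕜 X)) fun t => adjointOperator (T t) := by
  intro φ
  refine (@continuous_iff_continuousAt _ _ _ (mackeyTopology (topDualPairing 𝕜 X)) _).2
    fun t₀ => ?_
  refine (tendsto_mackey_iff (topDualPairing 𝕜 X)).2 fun K hK ε hε => ?_
  set p := pairingSeminorm (topDualPairing 𝕜 X) K with hp
  obtain ⟨α, hα⟩ := hqe
  obtain ⟨q, hq, hpq⟩ := hα p (continuous_pairingSeminorm _ hK)
  obtain ⟨K', hK', C, hqC⟩ := exists_le_pairingSeminorm _ hq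
  obtain ⟨L, hL, hK'L, h0L⟩ := exists_superset_mem_mackeySets _ hK'
    (zero_mem_mackeySets (topDualPairing 𝕜 X))
  have hbound : ∀ (t : ℝ≥0) ψ, p (adjointOperator (T t) ψ) ≤
      Real.exp (α * t) * (C * pairingSeminorm (topDualPairing 𝕜 X) L ψ) := by
    intro t ψ
    have h1 : adjointOperator (T t) ψ = ((Real.exp (α * t) : ℝ) : 𝕜) •
        (((Real.exp (-α * t) : ℝ) : 𝕜) • adjointOperator (T t)) ψ := by
      rw [LinearMap.smul_apply, smul_smul, ← RCLike.ofReal_mul, ← Real.exp_add]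
      simp
    rw [h1, map_smul_eq_mul, RCLike.norm_ofReal, abs_of_pos (Real.exp_pos _)]
    gcongr
    refine (hpq t ψ).trans ((hqC ψ).trans ?_)
    simp only [smul_apply]
    exact mul_le_mul_of_nonneg_left (pairingSeminorm_mono _ hK'.2 hL.2 hK'L ψ) C.2
  let m : ℝ := Real.exp (|α| * (t₀ + 1)) * C
  have hm0 : 0 ≤ m := by positivity
  have hm : ∀ t : ℝ≥0, t < t₀ + 1 → ∀ ψ, p (adjointOperator (T t) ψ) ≤
      m * pairingSeminorm (topDualPairing 𝕜 X) L ψ := by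
    intro t ht ψ
    refine (hbound t ψ).trans ?_
    rw [mul_assoc]
    gcongr ?_ * _
    refine Real.exp_le_exp.2 ?_
    have : (t : ℝ) ≤ t₀ + 1 := by exact_mod_cast ht.le
    exact (mul_le_mul_of_nonneg_right (le_abs_self α) t.coe_nonneg).trans
      (mul_le_mul_of_nonneg_left this (abs_nonneg α))
  let δ := ε / (4 * (m + 1))
  have hδ : 0 < δ := by positivity
  -- The functionals with norm continuous orbits form a convex set that approximates `φ` pointwise,
  -- hence uniformly on `L`.
  obtain ⟨ψ, hψ, hψφ⟩ := exists_forall_norm_sub_lt (topDualPairing 𝕜 X).flip hL.1 hL.2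
    ⟨0, h0L rfl⟩ (Φ := φ.toLinearMap)
    (@Continuous.continuousOn _ _ (weakTopology (topDualPairing 𝕜 X).flip) _ _ _
      (continuous_weakTopology_eval (topDualPairing 𝕜 X).flip φ))
    (H := {ψ | Continuous fun t => adjointOperator (T t) ψ})
    (fun ψ hψ χ hχ s t _ _ _ => by
      rw [mem_ofPred_eq]
      simp only [map_add, map_smul]
      exact ((continuous_const_smul (s : 𝕜)).comp hψ).add ((continuous_const_smul (t : 𝕜)).comp hχ))
    (fun x _ η hη => exists_norm_continuous_orbit_sub_lt hT φ x hη) hδ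
  have hd : pairingSeminorm (topDualPairing 𝕜 X) L (φ - ψ) ≤ δ :=
    pairingSeminorm_le _ hL.2 hδ.le fun x hx => (hψφ x hx).le
  obtain ⟨c, hc0, hc⟩ := exists_bound_mackeySet (norm_topDualPairing_le (𝕜 := 𝕜) (X := X)) hK
  have hev := (Metric.tendsto_nhds.1 (Continuous.tendsto hψ t₀) (ε / (2 * (c + 1)))
    (by positivity))
  filter_upwards [hev, gt_mem_nhds (show t₀ < t₀ + 1 from lt_add_one t₀)] with t ht ht1
  have h1 : p (adjointOperator (T t) ψ - adjointOperator (T t₀) ψ) < ε / 2 := by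
    rw [dist_eq_norm, lt_div_iff₀ (by positivity)] at ht
    refine (pairingSeminorm_le _ hK.2 (by positivity) fun x hx => hc x hx _).trans_lt ?_
    nlinarith [norm_nonneg (adjointOperator (T t) ψ - adjointOperator (T t₀) ψ)]
  have h2 : ∀ s : ℝ≥0, s < t₀ + 1 → p (adjointOperator (T s) (φ - ψ)) ≤ ε / 4 := by
    intro s hs
    refine (hm s hs _).trans ((mul_le_mul_of_nonneg_left hd hm0).trans ?_)
    rw [← mul_div_assoc, div_le_div_iff₀ (by positivity) (by norm_num)]
    nlinarith
  have h3 : adjointOperator (T t) φ - adjointOperator (T t₀) φ =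
      adjointOperator (T t) (φ - ψ) + (adjointOperator (T t) ψ - adjointOperator (T t₀) ψ) -
        adjointOperator (T t₀) (φ - ψ) := by
    simp only [map_sub]
    abel
  rw [h3]
  have h4 := map_sub_le_add p (adjointOperator (T t) (φ - ψ) +
    (adjointOperator (T t) ψ - adjointOperator (T t₀) ψ)) (adjointOperator (T t₀) (φ - ψ))
  have h5 := map_add_le_add p (adjointOperator (T t) (φ - ψ))
    (adjointOperator (T t) ψ - adjointOperator (T t₀) ψ)
  linarith [h2 t ht1, h2 t₀ (lt_add_one t₀)]

theorem isQuasiEquicontinuous_adjoint [CompleteSpace X] {T : ℝ≥0 → X →L[𝕜] X}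
    (hT : IsNormContinuousSemigroup T)
    (horb : HasContinuousOrbits (mackeyTopology (topDualPairing 𝕜 X))
      fun t => adjointOperator (T t)) :
    IsQuasiEquicontinuous (mackeyTopology (topDualPairing 𝕜 X))
      fun t => adjointOperator (T t) := by
  obtain ⟨M, ω, -, hM⟩ := hT.exists_norm_le
  refine isQuasiEquicontinuous_of_isQuasicomplete (B := topDualPairing 𝕜 X)
    (T := fun t => adjointOperator (T t)) (M := M) (ω := ω) norm_topDualPairing_le
    (fun x hx => ?_) isQuasicomplete_mackey_topDualPairing_flip (fun t => ?_) (fun t φ => ?_) horb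
  · exact SeparatingDual.eq_zero_of_forall_dual_eq_zero (R := 𝕜) hx
  · let _ := weakTopology (topDualPairing 𝕜 X)
    exact continuous_weakTopology_rng _ fun x =>
      continuous_weakTopology_eval (topDualPairing 𝕜 X) (T t x)
  · refine (ContinuousLinearMap.opNorm_comp_le φ (T t)).trans ?_
    rw [mul_comm]
    gcongr
    exact hM t

end Adjoint

/-! ### Radon measures as functionals on bounded continuous functions -/

section RadonMeasures

variable {E : Type*} [TopologicalSpace E] [T2Space E] [MeasurableSpace E] [BorelSpace E]

/-- A finite positive measure that is inner regular for compact sets is an element of `M_0(E)`. -/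
theorem exists_radonSpace_eq_integral (μ : Measure E) [IsFiniteMeasure μ] [μ.InnerRegular] :
    ∃ m : RadonSpace E, ∀ f, radonPairing E m f = ∫ x, f x ∂μ := by
  let m : ComplexMeasure E :=
    μ.toSignedMeasure.mapRange Complex.ofRealHom.toAddMonoidHom Complex.continuous_ofReal
  have hm : ∀ s, MeasurableSet s → m s = (μ.real s : ℂ) := fun s hs => by
    simp [m, VectorMeasure.mapRange_apply, Measure.toSignedMeasure_apply_measurable hs]
  have hme : ∀ s, MeasurableSet s → ‖m s‖ₑ = μ s := fun s hs => by
    rw [hm s hs, ← ofReal_norm, Complex.norm_real, Real.norm_of_nonneg measureReal_nonneg,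
      ofReal_measureReal]
  have hvar : m.variation = μ := by
    refine le_antisymm (VectorMeasure.variation_le_of_forall_enorm_le fun s hs => (hme s hs).le)
      (Measure.le_iff.2 fun s hs => ?_)
    rw [← hme s hs]
    exact VectorMeasure.enorm_measure_le_variation m s
  refine ⟨⟨m, by rw [hvar]; infer_instance, by rw [hvar]; infer_instance⟩, fun f => ?_⟩
  change VectorMeasure.integral m f (ContinuousLinearMap.mul ℝ ℂ) = _
  rw [VectorMeasure.integral, MeasureTheory.integral_eq_setToFun]
  simp only [hvar]
  apply setToFun_congr_left' _ _ (fun s hs _ => ?_)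
  ext
  simp [VectorMeasure.transpose, hm s hs, weightedSMul, mul_comm]

theorem exists_radonSpace_eq_eval (c : ℂ) (x : E) :
    ∃ m : RadonSpace E, ∀ f, radonPairing E m f = c * f x := by
  have : (Measure.dirac x).InnerRegular := ⟨fun A hA r hr => by
    by_cases hx : x ∈ A
    · refine ⟨{x}, singleton_subset_iff.2 hx, isCompact_singleton, hr.trans_le ?_⟩
      rw [Measure.dirac_apply_of_mem (mem_singleton x)]
      exact prob_le_one
    · rw [Measure.dirac_apply' x hA, indicator_of_notMem hx] at hr
      exact absurd hr not_lt_zero⟩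
  obtain ⟨m, hm⟩ := exists_radonSpace_eq_integral (Measure.dirac x)
  exact ⟨c • m, fun f => by simp [hm]⟩

theorem eq_zero_of_forall_radonPairing_eq_zero {f : E →ᵇ ℂ} (hf : ∀ m, radonPairing E m f = 0) :
    f = 0 := by
  ext x
  obtain ⟨m, hm⟩ := exists_radonSpace_eq_eval 1 x
  rw [← one_mul (f x), ← hm, hf]
  rfl

theorem norm_radonPairing_le (m : RadonSpace E) (f : E →ᵇ ℂ) :
    ‖radonPairing E m f‖ ≤ ‖m‖ * ‖f‖ := by
  have h := VectorMeasure.norm_integral_le_of_norm_le_const (μ := m.1) (f := f)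
    (B := ContinuousLinearMap.mul ℝ ℂ) (C := ‖f‖) (ae_of_all _ f.norm_coe_le_norm)
  rw [mul_comm ‖m‖]
  refine h.trans (mul_le_mul_of_nonneg_right ?_ measureReal_nonneg)
  exact mul_le_of_le_one_right (norm_nonneg _) (ContinuousLinearMap.opNorm_mul_le ℝ ℂ)

/-- A measure in `M_0(E)` is a continuous functional for the strict topology: if the compact sets
`K n` carry `|m|` up to `4⁻ⁿ`, then `w = 1 + ∑ 2ⁿ 1_{E \ K n}` is `|m|`-integrable and `1 / w`
vanishes at infinity. -/
theorem exists_norm_radonPairing_le (m : RadonSpace E) :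
    ∃ φ ∈ boundedVanishingAtInfinity E, ∃ C : ℝ, 0 ≤ C ∧
      ∀ f, ‖radonPairing E m f‖ ≤ C * strictSeminorm φ f := by
  have := m.2.2
  have hK : ∀ n : ℕ, ∃ K : Set E, IsCompact K ∧ m.1.variation Kᶜ ≤ (4 : ℝ≥0∞)⁻¹ ^ n := fun n => by
    obtain ⟨K, -, hK, h⟩ := MeasurableSet.univ.exists_isCompact_sdiff_lt
      (measure_ne_top m.1.variation univ) (ε := (4 : ℝ≥0∞)⁻¹ ^ n) (by simp)
    exact ⟨K, hK, by rw [compl_eq_univ_sdiff]; exact h.le⟩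
  choose K hK hKm using hK
  have hKmeas : ∀ n, MeasurableSet (K n)ᶜ := fun n => (hK n).measurableSet.compl
  let w : E → ℝ≥0∞ := fun x => 1 + ∑' n, (K n)ᶜ.indicator (fun _ => (2 : ℝ≥0∞) ^ n) x
  have hw1 : ∀ x, 1 ≤ w x := fun x => le_self_add
  have hwK : ∀ n, ∀ x ∉ K n, 2 ^ n ≤ w x := fun n x hx => by
    refine le_trans ?_ (le_add_self.trans' (ENNReal.le_tsum n))
    rw [indicator_of_mem (show x ∈ (K n)ᶜ from hx)]
  have hwm : Measurable w := by
    refine Measurable.const_add (Measurable.tsum fun n => ?_) 1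
    exact measurable_const.indicator (hKmeas n)
  have hwint : ∫⁻ x, w x ∂m.1.variation ≠ ∞ := by
    have h : ∫⁻ x, w x ∂m.1.variation ≤ m.1.variation univ + ∑' n, (2 : ℝ≥0∞)⁻¹ ^ n := by
      rw [lintegral_add_left measurable_const, lintegral_const, one_mul,
        lintegral_tsum fun n => (measurable_const.indicator (hKmeas n)).aemeasurable]
      gcongr with n
      rw [lintegral_indicator_const (hKmeas n)]
      calc (2 : ℝ≥0∞) ^ n * m.1.variation (K n)ᶜ ≤ 2 ^ n * 4⁻¹ ^ n := by gcongr; exact hKm n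
        _ = 2⁻¹ ^ n := by
          rw [← mul_pow]
          congr 1
          rw [show (4 : ℝ≥0∞) = 2 * 2 by norm_num, ENNReal.mul_inv (by simp) (by simp), ← mul_assoc,
            ENNReal.mul_inv_cancel (by simp) (by simp), one_mul]
    refine ne_top_of_le_ne_top (ENNReal.add_ne_top.2 ⟨measure_ne_top _ _, ?_⟩) h
    rw [ENNReal.tsum_geometric, ENNReal.inv_ne_top]
    simp
  let φ : E → ℂ := fun x => ((w x)⁻¹.toReal : ℂ)
  have hφ : ∀ x, ‖φ x‖ = (w x)⁻¹.toReal := fun x => by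
    simp only [φ, Complex.norm_real, Real.norm_of_nonneg ENNReal.toReal_nonneg]
  have hφ1 : ∀ x, ‖φ x‖ ≤ 1 := fun x => by
    rw [hφ]
    exact ENNReal.toReal_le_of_le_ofReal zero_le_one (by simpa using hw1 x)
  refine ⟨φ, ⟨⟨1, hφ1⟩, fun ε hε => ?_⟩, (∫⁻ x, w x ∂m.1.variation).toReal,
    ENNReal.toReal_nonneg, fun f => ?_⟩
  · obtain ⟨n, hn⟩ := exists_pow_lt_of_lt_one hε (by norm_num : (2 : ℝ)⁻¹ < 1)
    refine ⟨K n, hK n, fun x hx => ?_⟩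
    rw [hφ]
    refine le_trans (ENNReal.toReal_mono (by simp) (ENNReal.inv_le_inv.2 (hwK n x hx))) ?_
    simpa using hn.le
  · have hp : 0 ≤ strictSeminorm φ f := apply_nonneg _ _
    have hle : ∀ x, ‖φ x * f x‖ ≤ strictSeminorm φ f := fun x => by
      rw [strictSeminorm_apply φ hφ1]
      refine le_ciSup (f := fun x => ‖φ x * f x‖) ⟨‖f‖, ?_⟩ x
      rintro _ ⟨y, rfl⟩
      refine (norm_mul_le _ _).trans ?_
      exact (mul_le_of_le_one_left (norm_nonneg _) (hφ1 y)).trans (f.norm_coe_le_norm y)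
    have h := VectorMeasure.enorm_integral_le_lintegral_enorm (μ := m.1) (f := f)
      (B := ContinuousLinearMap.mul ℝ ℂ)
    have hmul : ‖ContinuousLinearMap.mul ℝ ℂ‖ₑ ≤ 1 := by
      rw [← ofReal_norm]
      exact ENNReal.ofReal_le_one.2 (ContinuousLinearMap.opNorm_mul_le ℝ ℂ)
    have h2 : ∫⁻ x, ‖f x‖ₑ ∂m.1.variation ≤
        (∫⁻ x, w x ∂m.1.variation) * ENNReal.ofReal (strictSeminorm φ f) := by
      rw [← lintegral_mul_const _ hwm]
      refine lintegral_mono_ae ((ae_lt_top hwm hwint).mono fun x hx => ?_)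
      have h0 : w x ≠ 0 := (zero_lt_one.trans_le (hw1 x)).ne'
      have h1 : ‖φ x‖ₑ = (w x)⁻¹ := by
        rw [← ofReal_norm, hφ, ENNReal.ofReal_toReal (by simpa using h0)]
      calc ‖f x‖ₑ = w x * ‖φ x * f x‖ₑ := by
            rw [enorm_mul, h1, ← mul_assoc, ENNReal.mul_inv_cancel h0 hx.ne, one_mul]
        _ ≤ w x * ENNReal.ofReal (strictSeminorm φ f) := by
            gcongr
            rw [← ofReal_norm]
            exact ENNReal.ofReal_le_ofReal (hle x)
    have h3 := (h.trans (mul_le_mul' hmul h2)).trans_eq (one_mul _)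
    have h4 := ENNReal.toReal_mono (by finiteness) h3
    rw [toReal_enorm, ENNReal.toReal_mul, ENNReal.toReal_ofReal hp] at h4
    exact h4

end RadonMeasures

/-! ### The strict topology is coarser than the Mackey topology -/

/-- In a disjoint union of compact spaces the index tends to infinity at infinity. -/
theorem tendsto_sigma_fst_coclosedCompact {K : ℕ → Type*} [∀ n, TopologicalSpace (K n)]
    [∀ n, CompactSpace (K n)] :
    Tendsto (Sigma.fst : (Σ n, K n) → ℕ) (coclosedCompact (Σ n, K n)) atTop := by
  refine tendsto_atTop.2 fun n => ?_
  have hclosed : IsClosed (Sigma.fst ⁻¹' Set.Iio n : Set (Σ n, K n)) :=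
    (isClosed_discrete _).preimage (continuous_sigma fun _ => continuous_const)
  have hc : IsCompact (Sigma.fst ⁻¹' Set.Iio n : Set (Σ n, K n)) := by
    have h : IsCompact (⋃ k ∈ Finset.range n, range (Sigma.mk k : K k → Σ n, K n)) :=
      (Finset.range n).isCompact_biUnion fun k _ => isCompact_range continuous_sigmaMk
    refine h.of_isClosed_subset hclosed ?_
    rintro ⟨k, x⟩ hk
    exact mem_iUnion₂.2 ⟨k, Finset.mem_range.2 hk, mem_range_self x⟩
  refine mem_of_superset
    (compl_mem_coclosedCompact.2 (hclosed.closure_eq.symm ▸ hc)) fun u hu => ?_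
  exact not_lt.1 (show ¬ u.1 < n from hu)

/-- If `‖φ‖ ≤ 2⁻ⁿ` off `K n`, then `‖φ x‖` is at most a constant times `2⁻ⁿ` for the least `n`
with `x ∈ K n`. -/
theorem exists_norm_le_pow {E : Type*} {φ : E → ℂ} {C : ℝ} (hC : ∀ x, ‖φ x‖ ≤ C) {K : ℕ → Set E}
    (hφK : ∀ n, ∀ x ∉ K n, ‖φ x‖ ≤ (2 : ℝ)⁻¹ ^ n) {x : E} (hx : φ x ≠ 0) :
    ∃ n, x ∈ K n ∧ ‖φ x‖ ≤ max C 2 * (2 : ℝ)⁻¹ ^ n := by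
  have hex : ∃ n, x ∈ K n := by
    by_contra! h
    obtain ⟨n, hn⟩ := exists_pow_lt_of_lt_one (norm_pos_iff.2 hx)
      (by norm_num : (2 : ℝ)⁻¹ < 1)
    exact absurd (hφK n x (h n)) (not_le.2 hn)
  classical
  refine ⟨Nat.find hex, Nat.find_spec hex, ?_⟩
  rcases hn : Nat.find hex with _ | n
  · rw [pow_zero, mul_one]
    exact (hC x).trans (le_max_left _ _)
  · have hxn : x ∉ K n := Nat.find_min hex (by omega)
    calc ‖φ x‖ ≤ 2⁻¹ ^ n := hφK n x hxn
      _ = 2 * 2⁻¹ ^ (n + 1) := by rw [pow_succ]; ring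
      _ ≤ max C 2 * 2⁻¹ ^ (n + 1) := by gcongr; exact le_max_right _ _

section WeightedEvaluations

variable {E : Type*} [TopologicalSpace E] [T2Space E] [MeasurableSpace E] [BorelSpace E]
  {U : Type*} [TopologicalSpace U]

/-- The measure that represents the integral is the image under `π` of `w ν`. -/
theorem exists_radonSpace_eq_integral_nnreal [T2Space U] [MeasurableSpace U] [BorelSpace U]
    (ν : Measure U) [IsFiniteMeasure ν] [ν.InnerRegular] {π : U → E} (hπ : Continuous π)
    {w : U → ℝ≥0} (hw : Continuous w) {C : ℝ≥0} (hC : ∀ u, w u ≤ C) :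
    ∃ m : RadonSpace E, ∀ f, radonPairing E m f = ∫ u, ((w u : ℝ) : ℂ) * f (π u) ∂ν := by
  have hle : ν.withDensity (fun u => (w u : ℝ≥0∞)) ≤ C • ν := by
    rw [show C • ν = ν.withDensity fun _ => (C : ℝ≥0∞) from (withDensity_const _).symm]
    exact withDensity_mono (ae_of_all _ fun u => ENNReal.coe_le_coe.2 (hC u))
  have := innerRegular_of_le hle
  have := isFiniteMeasure_of_le _ hle
  have := Measure.InnerRegular.map_of_continuous (μ := ν.withDensity fun u => (w u : ℝ≥0∞)) hπ
  obtain ⟨m, hm⟩ := exists_radonSpace_eq_integral ((ν.withDensity fun u => (w u : ℝ≥0∞)).map π)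
  refine ⟨m, fun f => ?_⟩
  rw [hm, integral_map hπ.aemeasurable f.continuous.aestronglyMeasurable,
    integral_withDensity_eq_integral_smul hw.measurable]
  rfl

/-- Bounded continuous densities and continuous images of Radon measures are Radon measures. -/
theorem exists_radonSpace_eq_integral_mul [T2Space U] [MeasurableSpace U] [BorelSpace U]
    (ν : Measure U) [IsFiniteMeasure ν] [ν.InnerRegular] {π : U → E} (hπ : Continuous π)
    {w : U → ℂ} (hw : Continuous w) {C : ℝ≥0} (hC : ∀ u, ‖w u‖ ≤ C) :
    ∃ m : RadonSpace E, ∀ f, radonPairing E m f = ∫ u, w u * f (π u) ∂ν := by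
  have hint : ∀ v : U → ℝ, Continuous v → (∀ u, |v u| ≤ ‖w u‖) → ∀ f : E →ᵇ ℂ,
      Integrable (fun u => (v u : ℂ) * f (π u)) ν := fun v hv hvw f => by
    refine Integrable.of_bound
      ((Complex.continuous_ofReal.comp hv).mul (f.continuous.comp hπ)).aestronglyMeasurable
      (C * ‖f‖) (ae_of_all _ fun u => ?_)
    rw [norm_mul, Complex.norm_real]
    exact mul_le_mul ((hvw u).trans (hC u)) (f.norm_coe_le_norm _) (norm_nonneg _) C.2
  have hreal : ∀ v : U → ℝ, Continuous v → (∀ u, |v u| ≤ ‖w u‖) →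
      ∃ m : RadonSpace E, ∀ f, radonPairing E m f = ∫ u, (v u : ℂ) * f (π u) ∂ν := by
    intro v hv hvw
    have hpos : ∀ v : U → ℝ, Continuous v → (∀ u, |v u| ≤ ‖w u‖) →
        ∃ m : RadonSpace E, ∀ f, radonPairing E m f = ∫ u, ((v u ⊔ 0 : ℝ) : ℂ) * f (π u) ∂ν :=
      fun v hv hvw => exists_radonSpace_eq_integral_nnreal ν hπ (w := fun u => (v u).toNNReal)
        (continuous_real_toNNReal.comp hv) (C := C) fun u =>
          Real.toNNReal_le_iff_le_coe.2 ((le_abs_self _).trans ((hvw u).trans (hC u)))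
    obtain ⟨m, hm⟩ := hpos v hv hvw
    obtain ⟨n, hn⟩ := hpos (fun u => -v u) hv.neg (fun u => by rw [abs_neg]; exact hvw u)
    refine ⟨m - n, fun f => ?_⟩
    rw [map_sub, LinearMap.sub_apply, hm, hn, ← integral_sub]
    · refine integral_congr_ae (ae_of_all _ fun u => ?_)
      have : v u = (v u ⊔ 0) - (-v u ⊔ 0) := by
        rcases le_total 0 (v u) with h | h <;> simp [h]
      change _ = (v u : ℂ) * f (π u)
      conv_rhs => rw [this]
      push_cast
      ring
    · refine hint _ (hv.sup continuous_const) (fun u => le_trans ?_ (hvw u)) f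
      rcases le_total 0 (v u) with h | h <;> simp [h]
    · refine hint _ (hv.neg.sup continuous_const) (fun u => le_trans ?_ (hvw u)) f
      rcases le_total 0 (v u) with h | h <;> simp [h]
  have hre := hint _ (Complex.continuous_re.comp hw) fun u => Complex.abs_re_le_norm _
  have him := hint _ (Complex.continuous_im.comp hw) fun u => Complex.abs_im_le_norm _
  obtain ⟨m, hm⟩ := hreal _ (Complex.continuous_re.comp hw) fun u => Complex.abs_re_le_norm _
  obtain ⟨n, hn⟩ := hreal _ (Complex.continuous_im.comp hw) fun u => Complex.abs_im_le_norm _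
  refine ⟨m + Complex.I • n, fun f => ?_⟩
  rw [map_add, map_smul, LinearMap.add_apply, LinearMap.smul_apply, hm, hn, smul_eq_mul,
    ← integral_const_mul, ← integral_add (hre f) ((him f).const_mul _)]
  refine integral_congr_ae (ae_of_all _ fun u => ?_)
  change _ = w u * f (π u)
  conv_rhs => rw [← Complex.re_add_im (w u)]
  simp only [Function.comp_apply]
  ring

/-- A family of multiples `g s • δ_{π s}` of point measures, where `g` vanishes at infinity on a
locally compact space, is contained in an absolutely convex weakly compact set of Radon measures.
Together with `0` the family is the image of the one-point compactification, and barycenters of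
measures on the latter are Radon measures. -/
theorem exists_mackeySet_weighted_eval [WeaklyLocallyCompactSpace U] [T2Space U] {π : U → E}
    (hπ : Continuous π) {g : U → ℂ} (hg : Continuous g)
    {C : ℝ≥0} (hC : ∀ u, ‖g u‖ ≤ C) (hg0 : Tendsto g (coclosedCompact U) (𝓝 0)) :
    ∃ L ∈ mackeySets (radonPairing E).flip,
      ∀ u, ∃ m ∈ L, ∀ f, radonPairing E m f = g u * f (π u) := by
  choose δ hδ using fun u => exists_radonSpace_eq_eval (g u) (π u)
  -- `ι` is weakly continuous at `∞` because `g` vanishes at infinity and each `f` is bounded.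
  let ι : OnePoint U → RadonSpace E := fun d => d.elim 0 δ
  have hι : ∀ f, Continuous fun d => (radonPairing E).flip f (ι d) := fun f => by
    refine OnePoint.continuous_iff _ |>.2 ⟨?_, ?_⟩
    · have h0 : (radonPairing E).flip f (ι OnePoint.infty) = 0 := by simp [ι]
      rw [h0]
      have : (fun u : U => (radonPairing E).flip f (ι u)) = fun u => g u * f (π u) :=
        funext fun u => hδ u f
      rw [this]
      refine squeeze_zero_norm (a := fun u => ‖g u‖ * ‖f‖) (fun u => ?_) ?_
      · rw [norm_mul]
        exact mul_le_mul_of_nonneg_left (f.norm_coe_le_norm _) (norm_nonneg _)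
      · simpa using hg0.norm.mul_const ‖f‖
    · exact (hg.mul (f.continuous.comp hπ)).congr fun u => (hδ u f).symm
  obtain ⟨L, hL, hιL⟩ := exists_mackeySet_of_closedHull_subset (radonPairing E).flip hι (by
    intro Φ hΦ
    let D := Metric.closedBall (0 : ℂ) 1 × OnePoint U
    let V := Metric.closedBall (0 : ℂ) 1 × U
    -- The Borel σ-algebras, which may differ from the product σ-algebras.
    let _ : MeasurableSpace D := borel D
    have : BorelSpace D := ⟨rfl⟩
    let _ : MeasurableSpace V := borel V
    have : BorelSpace V := ⟨rfl⟩
    obtain ⟨ρ, hρ, hρr, hint⟩ := exists_measure_of_mem_closure_convexHull (D := D)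
      (continuous_pi (continuous_smul_pairing (radonPairing E).flip hι)) hΦ
    let e : V → D := Prod.map id (↑)
    have he : IsOpenEmbedding e := IsOpenEmbedding.id.prodMap OnePoint.isOpenEmbedding_coe
    have hreg : (ρ.comap e).InnerRegular := Measure.InnerRegular.comap' ρ he
    have hfin : IsFiniteMeasure (ρ.comap e) := ⟨by
      rw [he.measurableEmbedding.comap_apply]
      exact measure_lt_top _ _⟩
    obtain ⟨m, hm⟩ := exists_radonSpace_eq_integral_mul (ρ.comap e) (π := fun z : V => π z.2)
      (hπ.comp continuous_snd) (w := fun z : V => z.1.1 * g z.2)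
      ((continuous_subtype_val.comp continuous_fst).mul (hg.comp continuous_snd)) (C := C)
      (fun z => by
        rw [norm_mul]
        exact (mul_le_of_le_one_left (norm_nonneg _) (mem_closedBall_zero_iff.1 z.1.2)).trans
          (hC _))
    refine ⟨m, funext fun f => ?_⟩
    -- The point at infinity does not contribute, since `ι ∞ = 0`.
    have h1 : ∫ d, (radonPairing E).flip f (d.1.1 • ι d.2) ∂ρ =
        ∫ d in range e, (radonPairing E).flip f (d.1.1 • ι d.2) ∂ρ := by
      refine (setIntegral_eq_integral_of_forall_compl_eq_zero fun d hd => ?_).symm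
      obtain ⟨c, d⟩ := d
      induction d with
      | infty => simp [ι]
      | coe u => exact absurd ⟨(c, u), rfl⟩ hd
    rw [hint, h1, ← he.measurableEmbedding.map_comap, he.measurableEmbedding.integral_map]
    refine (hm f).trans (integral_congr_ae (ae_of_all _ fun z => ?_))
    have h2 : (radonPairing E).flip f (z.1.1 • ι (z.2 : OnePoint U)) =
        z.1.1 * (g z.2 * f (π z.2)) := by
      rw [map_smul, smul_eq_mul]
      exact congrArg _ (hδ z.2 f)
    exact (mul_assoc _ _ _).trans h2.symm)
  exact ⟨L, hL, fun u => ⟨δ u, hιL ⟨u, rfl⟩, hδ u⟩⟩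

/-- For every sequence of compact sets `K n` there is an absolutely convex weakly compact set that
contains the measures `2⁻ⁿ δ_x` with `x ∈ K n`. They are indexed by the disjoint union of the
`K n`. -/
theorem exists_mackeySet_pow_mul_le {K : ℕ → Set E} (hK : ∀ n, IsCompact (K n)) :
    ∃ L ∈ mackeySets (radonPairing E).flip, ∀ n, ∀ x ∈ K n, ∀ f : E →ᵇ ℂ,
      (2 : ℝ)⁻¹ ^ n * ‖f x‖ ≤ pairingSeminorm (radonPairing E).flip L f := by
  have : ∀ n, CompactSpace (K n) := fun n => isCompact_iff_compactSpace.1 (hK n)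
  have : WeaklyLocallyCompactSpace (Σ n, K n) := ⟨fun ⟨n, x⟩ =>
    ⟨range (Sigma.mk n), isCompact_range continuous_sigmaMk,
      isOpen_range_sigmaMk.mem_nhds (mem_range_self x)⟩⟩
  let g : (Σ n, K n) → ℂ := fun u => (((2 : ℝ)⁻¹ ^ u.1 : ℝ) : ℂ)
  have hg : ∀ u, ‖g u‖ = (2 : ℝ)⁻¹ ^ u.1 := fun u => by
    rw [Complex.norm_real, Real.norm_of_nonneg (by positivity)]
  have hgc : Continuous g := continuous_sigma fun n =>
    continuous_const (y := (((2 : ℝ)⁻¹ ^ n : ℝ) : ℂ))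
  have hg0 : Tendsto g (coclosedCompact (Σ n, K n)) (𝓝 0) := by
    have h : Tendsto (fun n : ℕ => (((2 : ℝ)⁻¹ ^ n : ℝ) : ℂ)) atTop (𝓝 ((0 : ℝ) : ℂ)) :=
      (Complex.continuous_ofReal.tendsto 0).comp
        (tendsto_pow_atTop_nhds_zero_of_lt_one (by norm_num) (by norm_num))
    rw [Complex.ofReal_zero] at h
    exact h.comp tendsto_sigma_fst_coclosedCompact
  obtain ⟨L, hL, hmem⟩ := exists_mackeySet_weighted_eval (E := E) (U := Σ n, K n)
    (π := fun u => u.2) (continuous_sigma fun n => continuous_subtype_val)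
    (g := g) hgc (C := 1)
    (fun u => by
      rw [hg]
      exact pow_le_one₀ (by norm_num) (by norm_num)) hg0
  refine ⟨L, hL, fun n x hx f => ?_⟩
  obtain ⟨m, hm, hmf⟩ := hmem ⟨n, x, hx⟩
  have := norm_le_pairingSeminorm (radonPairing E).flip hL.2 hm f
  rw [LinearMap.flip_apply, hmf, norm_mul, hg] at this
  exact this

/-- The strict topology is coarser than the Mackey topology. -/
theorem exists_strictSeminorm_le {φ : E → ℂ} (hφ : φ ∈ boundedVanishingAtInfinity E) :
    ∃ L ∈ mackeySets (radonPairing E).flip, ∃ C : ℝ, 0 ≤ C ∧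
      ∀ f, strictSeminorm φ f ≤ C * pairingSeminorm (radonPairing E).flip L f := by
  obtain ⟨⟨C, hC⟩, hφK⟩ := hφ
  choose K hK hφK using fun n : ℕ => hφK ((2 : ℝ)⁻¹ ^ n) (by positivity)
  obtain ⟨L, hL, hle⟩ := exists_mackeySet_pow_mul_le hK
  have hC0 : 0 ≤ max C 2 := le_max_of_le_right zero_le_two
  refine ⟨L, hL, max C 2, hC0, fun f => ?_⟩
  rw [strictSeminorm_apply φ hC]
  refine Real.iSup_le (fun x => ?_) (mul_nonneg hC0 (apply_nonneg _ _))
  by_cases hx : φ x = 0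
  · rw [hx, zero_mul, norm_zero]
    exact mul_nonneg hC0 (apply_nonneg _ _)
  · obtain ⟨n, hxn, hn⟩ := exists_norm_le_pow hC hφK hx
    rw [norm_mul]
    refine (mul_le_mul_of_nonneg_right hn (norm_nonneg _)).trans ?_
    rw [mul_assoc]
    exact mul_le_mul_of_nonneg_left (hle n x hxn f) hC0

/-- Completeness for the strict topology passes to the Mackey topology, which is finer and has the
same continuous point evaluations by Radon measures: a Mackey-Cauchy filter has a strict limit,
hence a weak one, and Mackey balls are weakly closed. -/
theorem isQuasicomplete_mackey_radonPairing
    (hE : @CompleteSpace (E →ᵇ ℂ) (strictUniformity E)) :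
    IsQuasicomplete ℂ (mackeyUniformity (radonPairing E).flip) := by
  intro S _ hS F hF hFS
  obtain ⟨hne, hcau⟩ := (cauchy_mackey_iff _).1 hF
  have hstrict : @Cauchy _ (strictUniformity E) F := by
    refine cauchy_seminormUniformity_iff.2 ⟨hne, ?_⟩
    rintro _ ⟨φ, hφ, rfl⟩ ε hε
    obtain ⟨L, hL, C, hC, hle⟩ := exists_strictSeminorm_le hφ
    obtain ⟨A, hA, hAε⟩ := hcau L hL (ε / (C + 1)) (by positivity)
    refine ⟨A, hA, fun f hf h hh => (hle _).trans_lt ?_⟩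
    have := hAε f hf h hh
    calc C * pairingSeminorm (radonPairing E).flip L (f - h)
        ≤ (C + 1) * pairingSeminorm (radonPairing E).flip L (f - h) := by
          gcongr
          linarith
      _ < (C + 1) * (ε / (C + 1)) := by gcongr
      _ = ε := by field_simp
  obtain ⟨f, hf⟩ := @CompleteSpace.complete _ (strictUniformity E) hE F hstrict
  have hweak : ∀ m, Tendsto (fun h => radonPairing E m h) F (𝓝 (radonPairing E m f)) := by
    intro m
    obtain ⟨φ, hφ, C, hC, hle⟩ := exists_norm_radonPairing_le m
    refine Metric.tendsto_nhds.2 fun ε hε => ?_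
    have := tendsto_seminormUniformity_iff.1 (show Tendsto id F _ from hf) _
      (mem_image_of_mem _ hφ) (ε / (C + 1)) (by positivity)
    refine this.mono fun h hh => ?_
    rw [dist_eq_norm, ← map_sub]
    refine (hle _).trans_lt ?_
    have h0 : 0 ≤ strictSeminorm φ (h - f) := apply_nonneg _ _
    calc C * strictSeminorm φ (h - f) ≤ (C + 1) * strictSeminorm φ (h - f) := by
          gcongr
          linarith
      _ < (C + 1) * (ε / (C + 1)) := by gcongr; exact hh
      _ = ε := by field_simp
  have hlim : F ≤ @nhds _ (mackeyTopology (radonPairing E).flip) f := by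
    refine (tendsto_mackey_iff _ (u := id)).2 fun L hL ε hε => ?_
    obtain ⟨A, hA, hAε⟩ := hcau L hL (ε / 2) (by linarith)
    refine mem_of_superset hA fun h hh => ?_
    refine (pairingSeminorm_le _ hL.2 (c := ε / 2) (by linarith) fun m hm => ?_).trans_lt
      (by linarith)
    have ht : Tendsto (fun k => ‖radonPairing E m (h - k)‖) F
        (𝓝 ‖radonPairing E m (h - f)‖) := by
      simp only [map_sub]
      exact (tendsto_const_nhds.sub (hweak m)).norm
    refine le_of_tendsto ht (mem_of_superset hA fun k hk => ?_)
    exact (norm_le_pairingSeminorm (radonPairing E).flip hL.2 hm _).trans (hAε h hh k hk).le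
  refine ⟨f, ?_, hlim⟩
  let _ := mackeyTopology (radonPairing E).flip
  exact hS.mem_of_tendsto (f := id) hlim (le_principal_iff.1 hFS)

end WeightedEvaluations

end DualPair

theorem corollaryc :
    -- the general statement
    (∀ (𝕜 : Type*) [RCLike 𝕜]
      (X : Type*) [NormedAddCommGroup X] [NormedSpace 𝕜 X] [CompleteSpace X]
      (Y : Type*) [NormedAddCommGroup Y] [NormedSpace 𝕜 Y] [CompleteSpace Y]
      (B : X →ₗ[𝕜] Y →ₗ[𝕜] 𝕜), IsNormingDualPair B →
      IsQuasicomplete 𝕜 (mackeyUniformity B.flip) →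
      ∀ T : ℝ≥0 → X →ₗ[𝕜] X, IsPairSemigroup B T →
        HasContinuousOrbits (mackeyTopology B) T →
        IsQuasiEquicontinuous (mackeyTopology B) T) ∧
    -- adjoint semigroups on the pair `(X*, X)`
    (∀ (𝕜 : Type*) [RCLike 𝕜]
      (X : Type*) [NormedAddCommGroup X] [NormedSpace 𝕜 X] [CompleteSpace X]
      (T : ℝ≥0 → X →L[𝕜] X), IsNormContinuousSemigroup T →
        (HasContinuousOrbits (mackeyTopology (topDualPairing 𝕜 X))
            (fun t => adjointOperator (T t)) ↔
          IsQuasiEquicontinuous (mackeyTopology (topDualPairing 𝕜 X))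
            (fun t => adjointOperator (T t)))) ∧
    -- semigroups on the pair `(M_0(E), C_b(E))`
    (∀ (E : Type*) [TopologicalSpace E] [T35Space E] [MeasurableSpace E] [BorelSpace E],
      @CompleteSpace (E →ᵇ ℂ) (strictUniformity E) →
      ∀ T : ℝ≥0 → RadonSpace E →ₗ[ℂ] RadonSpace E,
        IsIntegrableSemigroup (radonPairing E) T →
        HasContinuousOrbits (mackeyTopology (radonPairing E)) T →
        IsQuasiEquicontinuous (mackeyTopology (radonPairing E)) T) := by
  refine ⟨?_, ?_, ?_⟩
  · intro 𝕜 _ X _ _ _ Y _ _ _ B hB hq T hT horb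
    obtain ⟨M, ω, hM⟩ := hT.exists_type
    exact DualPair.isQuasiEquicontinuous_of_isQuasicomplete (DualPair.norm_pairing_le hB)
      (fun _ => DualPair.eq_zero_of_forall_pairing_eq_zero hB) hq hT.weak_continuous hM.2 horb
  · intro 𝕜 _ X _ _ _ T hT
    exact ⟨DualPair.isQuasiEquicontinuous_adjoint hT, DualPair.hasContinuousOrbits_adjoint hT⟩
  · intro E _ _ _ _ hE T hT horb
    obtain ⟨M, ω, hM⟩ := hT.exists_type
    exact DualPair.isQuasiEquicontinuous_of_isQuasicomplete DualPair.norm_radonPairing_le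
      (fun f => DualPair.eq_zero_of_forall_radonPairing_eq_zero)
      (DualPair.isQuasicomplete_mackey_radonPairing hE) hT.weak_continuous hM.2 horb
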